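/- \textbf{Setting.} Fix a first-order language $\mathscr L$: a collection $\mathscr L_q$ of quantifier symbols and collections $\mathscr L_n$ ($n\in\omega$) of $n$-ary connectives, with designated $e\in\mathscr L_0$ and $\otimes\in\mathscr L_2$. A signature $Sg$ consists of sorts, typed function symbols $f:\sigma_1,\dots,\sigma_n\to\tau$ and typed relation symbols $R\subseteq\sigma_1,\dots,\sigma_n$. Terms-in-context $M:\tau\,[\Gamma]$ are built from variables and function symbols; formulas-in-context $\phi\,[\Gamma]$ are built from $R(M_1,\dots,M_n)$ and $M_1=_\sigma M_2$ by the connectives $\Diamond(\phi_1,\dots,\phi_n)$ and the quantifiers $\Omega_{x:\sigma}(\phi)\,[\Gamma]$ for $\phi\,[\Gamma,x:\sigma]$. All are taken up to renaming of bound variables and of the variables of the context. An \emph{assertion} is an equation $M=N:\tau\,[\Gamma]$ or a sequent $\phi_1,\dots,\phi_n\vdash\psi\,[\Gamma]$, $n\ge 0$; an $Sg$-\emph{theory} is a set of $Sg$-assertions. A \emph{logic} $\mathcal L$ is a closure operator on the lattice of $Sg$-theories for each signature $Sg$, whose closed theories (the \emph{$\mathcal L$-theories}) are closed under the rules of equational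 logic: reflexivity, symmetry, transitivity, and: from $M=M':\sigma\,[\Delta]$ and $N=N':\tau\,[\Gamma,x:\sigma,\Gamma']$ infer $N[M/x]=N'[M'/x]:\tau\,[\Gamma,\Gamma']$, where the typed variables of $\Delta$ are among those of $\Gamma,\Gamma'$. Write $T\vdash_{\mathcal L}T'$ if $T'$ is contained in the $\mathcal L$-closure of $T$. The \emph{minimal logic} $\mathcal L^m$ is given by the rules of equational logic and the following rules, for all $\Omega\in\mathscr L_q$, all connectives $\Diamond$ and all lists $\Phi,\Psi$ of formulas: (Ax) $\phi\vdash\phi\,[\Gamma]$; (Cut) from $\phi\vdash\psi\,[\Gamma]$ and $\psi\vdash\theta\,[\Gamma]$ infer $\phi\vdash\theta\,[\Gamma]$; (Cwk) from $\Phi\vdash\psi\,[\Gamma]$ infer $\Phi\vdash\psi\,[\Gamma,x:\sigma]$; (Sub) from $M=M':\sigma\,[\Delta]$ and $\Phi\vdash\psi\,[\Gamma,x:\sigma,\Gamma']$ infer $\Phi[M/x]\vdash\psi[M'/x]\,[\Gamma,\Gamma']$, where the typed variables of $\Delta$ are among those of $\Gamma,\Gamma'$; ($\Omega$-Con) from $\phi\dashv\vdash\psi\,[\Gamma,x:\sigma]$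 infer $\Omega_{x:\sigma}(\phi)\vdash\Omega_{x:\sigma}(\psi)\,[\Gamma]$; ($\Diamond$-Cong) from $\phi_i\dashv\vdash\phi_i'\,[\Gamma]$ for all $i$ infer $\Diamond(\phi_1,\dots,\phi_n)\vdash\Diamond(\phi_1',\dots,\phi_n')\,[\Gamma]$; ($\otimes$-Ref) $\Phi,\alpha,\beta,\Psi\vdash\theta\,[\Gamma]$ and $\Phi,\alpha\otimes\beta,\Psi\vdash\theta\,[\Gamma]$ can be inferred from each other; ($e$-Ref) $\Phi,e,\Psi\vdash\phi\,[\Gamma]$ and $\Phi,\Psi\vdash\phi\,[\Gamma]$ can be inferred from each other. A \emph{prop-category} $(\mathcal C,P)$ is a category with designated finite products and a functor $P:\mathcal C^{op}\to\mathbf{Pos}$. $\mathrm{Ob}(\mathbf{FA})$ is the class of prop-categories equipped with an interpretation of each connective on every $P(c)$, elements $Eq_c\in P(c\times c)$ and maps $\Omega_{b,c}:P(b\times c)\to P(b)$ for $\Omega\in\mathscr L_q$, such that: each $P(f)$ preserves the connectives; $\Omega_{b,c}$ is natural in $b$; $(P(c),\otimes,e)$ is a monoid (not necessarily ordered); $\Omega_{b,1}\circ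 P(\pi_1)=\mathrm{id}$ and $\Omega_{b,c\times d}\circ P(a_{b,c,d})=\Omega_{b,c}\circ\Omega_{b\times c,d}$, where $a_{b,c,d}:b\times(c\times d)\cong(b\times c)\times d$; $Eq_1=e_{1\times1}$; and $Eq_{c_1\times c_2}=P(p_1)(Eq_{c_1})\otimes P(p_2)(Eq_{c_2})$, where $p_i:(c_1\times c_2)\times(c_1\times c_2)\to c_i\times c_i$ is the map given by the $i$-th components. An $Sg$-structure $S$ in $(\mathcal C,P)$ interprets sorts as objects, function symbols as morphisms between the corresponding products and relation symbols as elements of $P$ of the corresponding products; terms and formulas are interpreted recursively in the usual way. $S$ satisfies $M=N:\tau\,[\Gamma]$ if the two interpretations are equal, and $\phi_1,\dots,\phi_n\vdash\psi\,[\Gamma]$ if $[\![\phi_1]\!]\otimes\dots\otimes[\![\phi_n]\!]\le[\![\psi]\!]$ (with $e$ on the left if $n=0$). $\mathrm{Th}(S)$ is the set of assertions that $S$ satisfies, and $S$ is a $T$-model if $T\subseteq\mathrm{Th}(S)$. For $\mathcal K\subseteq\mathrm{Ob}(\mathbf{FA})$, $T\vDash_{\mathcal K}T'$ means that every $T$-model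 in a member of $\mathcal K$ is a $T'$-model. For a theory $T$, the \emph{classifying prop-category} $(\mathcal C_T,P_T)$ has as objects the contexts (with concatenation as product), as morphisms $\Gamma'\to\Gamma$ the lists of terms in context $\Gamma'$, one for each variable of $\Gamma$, modulo the equations in $T$, with substitution as composition; $P_T(\Gamma)$ is the set of formulas in context $\Gamma$ modulo $\phi\sim\psi\iff(\phi\vdash\psi\,[\Gamma]),(\psi\vdash\phi\,[\Gamma])\in T$, ordered by $[\phi]\le[\psi]\iff(\phi\vdash\psi\,[\Gamma])\in T$. $P_T$ acts on morphisms by substitution, connectives act on representatives, $\Omega_{\Gamma,\Gamma'}[\phi]=[\Omega_{y_1:\tau_1}\cdots\Omega_{y_m:\tau_m}\phi]$ for $\Gamma'=y_1:\tau_1,\dots,y_m:\tau_m$, and $Eq_\Gamma=[x_1=x_1'\otimes\dots\otimes x_n=x_n']$ ($=[e]$ if $\Gamma$ is empty). The construction \emph{can be carried out} if all this is well defined. A logic $\mathcal L$ is \emph{adequate} if for every $\mathcal L$-theory $T$ the construction can be carried out, $(\mathcal C_T,P_T)\in\mathrm{Ob}(\mathbf{FA})$, and $(\mathcal C_T,P_T)$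 contains a generic $T$-model, i.e. a structure $G$ with $\mathrm{Th}(G)=T$. \textbf{Theorem.} The logic $\mathcal L^m$ is adequate. It is sound with respect to every class $\mathcal K\subseteq\mathrm{Ob}(\mathbf{FA})$: $T\vdash_{\mathcal L^m}T'$ implies $T\vDash_{\mathcal K}T'$. If $\mathcal K\subseteq\mathrm{Ob}(\mathbf{FA})$ contains $(\mathcal C_T,P_T)$ for every $\mathcal L^m$-theory $T$, then $\mathcal L^m$ is sound and complete with respect to $\mathcal K$: for all signatures $Sg$ and $Sg$-theories $T,T'$, $$T\vdash_{\mathcal L^m}T'\iff T\vDash_{\mathcal K}T'.$$ \textbf{Corollary.} If a logic $\mathcal L$ is adequate, then $\vdash_{\mathcal L}\;\supseteq\;\vdash_{\mathcal L^m}$, i.e. $T\vdash_{\mathcal L^m}T'$ implies $T\vdash_{\mathcal L}T'$. -/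

import Mathlib

set_option linter.checkUnivs false

open CategoryTheory MonoidalCategory CartesianMonoidalCategory Opposite

universe u o h p

namespace FibLogic

/-! ## Syntax -/

/-- A first-order language: quantifier symbols, propositional connectives with their arities,
and the designated connectives `e` (nullary) and `⊗` (binary). -/
structure FOLanguage : Type (u + 1) where
  Quant : Type u
  Conn : ℕ → Type u
  unit : Conn 0
  tensor : Conn 2

/-- Contexts up to renaming of their variables, that is, lists of sorts.  The most recently added
variable comes first: `[x₁ : σ₁, …, xₙ : σₙ]` is the list `[σₙ, …, σ₁]`.  So `Γ, x : σ` is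
`σ :: Γ`, and the concatenation `Γ, Δ` of contexts is `Δ ++ Γ`. -/
abbrev Ctx (S : Type u) : Type u := List S

/-- A many-sorted signature.  Typings of function and relation symbols use lists of sorts with the
same convention as contexts. -/
structure Signature : Type (u + 1) where
  Srt : Type u
  Func : Type u
  dom : Func → Ctx Srt
  cod : Func → Srt
  Rel : Type u
  arity : Rel → Ctx Srt

/-- The variables of sort `σ` in a context (well-typed de Bruijn indices). -/
inductive Var {S : Type u} : Ctx S → S → Type u
  | zero {Γ : Ctx S} {σ : S} : Var (σ :: Γ) σ
  | succ {Γ : Ctx S} {σ τ : S} (v : Var Γ τ) : Var (σ :: Γ) τ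

/-- `Term Sg Γ τ` is the type of terms-in-context `M : τ [Γ]`. -/
inductive Term (Sg : Signature.{u}) (Γ : Ctx Sg.Srt) : Sg.Srt → Type u
  | var {σ : Sg.Srt} (v : Var Γ σ) : Term Sg Γ σ
  | app (f : Sg.Func) (args : ∀ σ : Sg.Srt, Var (Sg.dom f) σ → Term Sg Γ σ) :
      Term Sg Γ (Sg.cod f)

/-- `Formula L Sg Γ` is the type of formulas-in-context `φ : prop [Γ]` (up to `α`-equivalence). -/
inductive Formula (L : FOLanguage.{u}) (Sg : Signature.{u}) : Ctx Sg.Srt → Type u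
  | rel {Γ : Ctx Sg.Srt} (R : Sg.Rel)
      (args : ∀ σ : Sg.Srt, Var (Sg.arity R) σ → Term Sg Γ σ) : Formula L Sg Γ
  | eq {Γ : Ctx Sg.Srt} {σ : Sg.Srt} (M N : Term Sg Γ σ) : Formula L Sg Γ
  | conn {Γ : Ctx Sg.Srt} {n : ℕ} (k : L.Conn n) (φ : Fin n → Formula L Sg Γ) : Formula L Sg Γ
  | quant {Γ : Ctx Sg.Srt} (Q : L.Quant) (σ : Sg.Srt) (φ : Formula L Sg (σ :: Γ)) : Formula L Sg Γ

/-- The formula `e`. -/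
def Formula.unit {L : FOLanguage.{u}} {Sg : Signature.{u}} {Γ : Ctx Sg.Srt} : Formula L Sg Γ :=
  .conn L.unit Fin.elim0

/-- The formula `φ ⊗ ψ`. -/
def Formula.tensor {L : FOLanguage.{u}} {Sg : Signature.{u}} {Γ : Ctx Sg.Srt}
    (φ ψ : Formula L Sg Γ) : Formula L Sg Γ :=
  .conn L.tensor ![φ, ψ]

/-! ## Substitution -/

/-- Sort-preserving maps from the variables of `Γ` to the variables of `Δ`. -/
abbrev Ren {S : Type u} (Γ Δ : Ctx S) : Type u := ∀ σ : S, Var Γ σ → Var Δ σ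

/-- Simultaneous substitutions: a term in context `Δ` for each variable of `Γ`. -/
abbrev Subst (Sg : Signature.{u}) (Γ Δ : Ctx Sg.Srt) : Type u :=
  ∀ σ : Sg.Srt, Var Γ σ → Term Sg Δ σ

def Term.rename {Sg : Signature.{u}} {Γ Δ : Ctx Sg.Srt} (ρ : Ren Γ Δ) :
    {τ : Sg.Srt} → Term Sg Γ τ → Term Sg Δ τ
  | _, .var v => .var (ρ _ v)
  | _, .app f args => .app f fun σ v => (args σ v).rename ρ

def Term.subst {Sg : Signature.{u}} {Γ Δ : Ctx Sg.Srt} (γ : Subst Sg Γ Δ) :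
    {τ : Sg.Srt} → Term Sg Γ τ → Term Sg Δ τ
  | _, .var v => γ _ v
  | _, .app f args => .app f fun σ v => (args σ v).subst γ

/-- Extension of a substitution under a binder. -/
def Subst.lift {Sg : Signature.{u}} {Γ Δ : Ctx Sg.Srt} (γ : Subst Sg Γ Δ) (σ : Sg.Srt) :
    Subst Sg (σ :: Γ) (σ :: Δ)
  | _, .zero => .var .zero
  | _, .succ v => (γ _ v).rename fun _ => .succ

/-- Capture-avoiding simultaneous substitution in formulas. -/
def Formula.subst {L : FOLanguage.{u}} {Sg : Signature.{u}} :
    {Γ Δ : Ctx Sg.Srt} → Subst Sg Γ Δ → Formula L Sg Γ → Formula L Sg Δ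
  | _, _, γ, .rel R args => .rel R fun σ v => (args σ v).subst γ
  | _, _, γ, .eq M N => .eq (M.subst γ) (N.subst γ)
  | _, _, γ, .conn k φ => .conn k fun i => (φ i).subst γ
  | _, _, γ, .quant Q σ φ => .quant Q σ (φ.subst (γ.lift σ))

/-- The weakening `φ [Γ, x : σ]` of `φ [Γ]`. -/
def Formula.weaken {L : FOLanguage.{u}} {Sg : Signature.{u}} {Γ : Ctx Sg.Srt} (σ : Sg.Srt)
    (φ : Formula L Sg Γ) : Formula L Sg (σ :: Γ) :=
  φ.subst fun _ v => .var (.succ v)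

/-- The inclusion of (the variables of) `Γ` in `Γ, Δ`. -/
def Var.inl {S : Type u} {Γ : Ctx S} {τ : S} : (Δ : Ctx S) → Var Γ τ → Var (Δ ++ Γ) τ
  | [], v => v
  | _ :: Δ, v => .succ (Var.inl Δ v)

/-- The inclusion of (the variables of) `Δ` in `Γ, Δ`. -/
def Var.inr {S : Type u} (Γ : Ctx S) {τ : S} : {Δ : Ctx S} → Var Δ τ → Var (Δ ++ Γ) τ
  | _, .zero => .zero
  | _, .succ v => .succ (Var.inr Γ v)

/-- The substitution on `Γ, Δ` that is `γ` on `Γ` and `δ` on `Δ`. -/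
def Subst.append {Sg : Signature.{u}} {Γ Θ : Ctx Sg.Srt} (γ : Subst Sg Γ Θ) :
    {Δ : Ctx Sg.Srt} → Subst Sg Δ Θ → Subst Sg (Δ ++ Γ) Θ
  | [], _ => γ
  | _ :: _, δ => fun
    | _, .zero => δ _ .zero
    | _, .succ v => Subst.append γ (fun _ w => δ _ (.succ w)) _ v

/-- The substitution on `Γ, x : σ, Δ` that sends `x` to `M` and is `γ` on the variables of
`Γ, Δ`. -/
def Subst.insert {Sg : Signature.{u}} {Γ Θ : Ctx Sg.Srt} {σ : Sg.Srt} (M : Term Sg Θ σ) :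
    (Δ : Ctx Sg.Srt) → Subst Sg (Δ ++ Γ) Θ → Subst Sg (Δ ++ σ :: Γ) Θ
  | [], γ => fun
    | _, .zero => M
    | _, .succ v => γ _ v
  | _ :: Δ, γ => fun
    | _, .zero => γ _ .zero
    | _, .succ v => Subst.insert M Δ (fun _ w => γ _ (.succ w)) _ v

/-- The substitution `[M/x]` of `M : σ [Γ, Δ]` for `x` in the context `Γ, x : σ, Δ`. -/
def Subst.single {Sg : Signature.{u}} (Γ Δ : Ctx Sg.Srt) {σ : Sg.Srt}
    (M : Term Sg (Δ ++ Γ) σ) : Subst Sg (Δ ++ σ :: Γ) (Δ ++ Γ) :=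
  Subst.insert M Δ fun _ v => .var v

/-! ### Substitution lemmas -/

theorem Term.subst_var {Sg : Signature.{u}} {Γ : Ctx Sg.Srt} {τ : Sg.Srt} (M : Term Sg Γ τ) :
    M.subst (fun _ v => .var v) = M := by
  induction M with
  | var v => rfl
  | app f args ih => simp only [Term.subst]; congr; funext σ v; exact ih σ v

theorem Term.subst_subst {Sg : Signature.{u}} {Γ Δ Θ : Ctx Sg.Srt} (γ : Subst Sg Γ Δ)
    (δ : Subst Sg Δ Θ) {τ : Sg.Srt} (M : Term Sg Γ τ) :
    (M.subst γ).subst δ = M.subst fun σ v => (γ σ v).subst δ := by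
  induction M with
  | var v => rfl
  | app f args ih => simp only [Term.subst]; congr; funext σ v; exact ih σ v

theorem Term.subst_rename {Sg : Signature.{u}} {Γ Δ Θ : Ctx Sg.Srt} (ρ : Ren Γ Δ)
    (δ : Subst Sg Δ Θ) {τ : Sg.Srt} (M : Term Sg Γ τ) :
    (M.rename ρ).subst δ = M.subst fun σ v => δ σ (ρ σ v) := by
  induction M with
  | var v => rfl
  | app f args ih => simp only [Term.subst, Term.rename]; congr; funext σ v; exact ih σ v

theorem Term.rename_subst {Sg : Signature.{u}} {Γ Δ Θ : Ctx Sg.Srt} (γ : Subst Sg Γ Δ)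
    (ρ : Ren Δ Θ) {τ : Sg.Srt} (M : Term Sg Γ τ) :
    (M.subst γ).rename ρ = M.subst fun σ v => (γ σ v).rename ρ := by
  induction M with
  | var v => rfl
  | app f args ih => simp only [Term.subst, Term.rename]; congr; funext σ v; exact ih σ v

theorem Subst.lift_var {Sg : Signature.{u}} {Γ : Ctx Sg.Srt} (σ : Sg.Srt) :
    Subst.lift (fun τ (v : Var Γ τ) => Term.var (Sg := Sg) v) σ = fun _ v => .var v := by
  funext τ v
  cases v <;> rfl

theorem Subst.lift_comp {Sg : Signature.{u}} {Γ Δ Θ : Ctx Sg.Srt} (γ : Subst Sg Γ Δ)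
    (δ : Subst Sg Δ Θ) (σ : Sg.Srt) :
    (fun τ v => ((γ.lift σ) τ v).subst (δ.lift σ)) =
      Subst.lift (fun τ v => (γ τ v).subst δ) σ := by
  funext τ v
  cases v with
  | zero => rfl
  | succ v => simp only [Subst.lift, Term.subst_rename, Term.rename_subst]

theorem Formula.subst_var {L : FOLanguage.{u}} {Sg : Signature.{u}} {Γ : Ctx Sg.Srt}
    (φ : Formula L Sg Γ) : φ.subst (fun _ v => .var v) = φ := by
  induction φ with
  | rel R args => simp only [Formula.subst, Term.subst_var]
  | eq M N => simp only [Formula.subst, Term.subst_var]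
  | conn k φ ih => simp only [Formula.subst, ih]
  | quant Q σ φ ih => simp only [Formula.subst, Subst.lift_var, ih]

theorem Formula.subst_subst {L : FOLanguage.{u}} {Sg : Signature.{u}} {Γ Δ Θ : Ctx Sg.Srt}
    (γ : Subst Sg Γ Δ) (δ : Subst Sg Δ Θ) (φ : Formula L Sg Γ) :
    (φ.subst γ).subst δ = φ.subst fun σ v => (γ σ v).subst δ := by
  induction φ generalizing Δ Θ with
  | rel R args => simp only [Formula.subst, Term.subst_subst]
  | eq M N => simp only [Formula.subst, Term.subst_subst]
  | conn k φ ih => simp only [Formula.subst, ih]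
  | quant Q σ φ ih => simp only [Formula.subst, ih, Subst.lift_comp]

theorem Subst.append_inl {Sg : Signature.{u}} {Γ Θ : Ctx Sg.Srt} (γ : Subst Sg Γ Θ)
    {Δ : Ctx Sg.Srt} (δ : Subst Sg Δ Θ) {τ : Sg.Srt} (v : Var Γ τ) :
    γ.append δ τ (v.inl Δ) = γ τ v := by
  induction Δ with
  | nil => rfl
  | cons σ Δ ih => exact ih _

theorem Subst.append_inr {Sg : Signature.{u}} {Γ Θ : Ctx Sg.Srt} (γ : Subst Sg Γ Θ)
    {Δ : Ctx Sg.Srt} (δ : Subst Sg Δ Θ) {τ : Sg.Srt} (v : Var Δ τ) :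
    γ.append δ τ (v.inr Γ) = δ τ v := by
  induction v with
  | zero => rfl
  | succ v ih => exact ih _

theorem Var.append_cases {S : Type u} {Γ Δ : Ctx S} {τ : S} (v : Var (Δ ++ Γ) τ) :
    (∃ w : Var Γ τ, v = w.inl Δ) ∨ ∃ w : Var Δ τ, v = w.inr Γ := by
  induction Δ with
  | nil => exact .inl ⟨v, rfl⟩
  | cons σ Δ ih =>
    cases v with
    | zero => exact .inr ⟨.zero, rfl⟩
    | succ v =>
      rcases ih v with ⟨w, rfl⟩ | ⟨w, rfl⟩
      · exact .inl ⟨w, rfl⟩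
      · exact .inr ⟨.succ w, rfl⟩

theorem Subst.append_eta {Sg : Signature.{u}} {Γ Δ Θ : Ctx Sg.Srt} (γ : Subst Sg (Δ ++ Γ) Θ) :
    Subst.append (fun _ v => γ _ (Var.inl Δ v)) (fun _ v => γ _ (Var.inr Γ v)) = γ := by
  funext σ v
  rcases v.append_cases with ⟨w, rfl⟩ | ⟨w, rfl⟩
  · rw [Subst.append_inl]
  · rw [Subst.append_inr]

/-! ## Assertions, theories, logics -/

/-- The `Sg`-assertions: equations-in-context `M = N : τ [Γ]` and sequents-in-context
`φ₁, …, φₙ ⊢ ψ [Γ]`. -/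
inductive Assertion (L : FOLanguage.{u}) (Sg : Signature.{u}) : Type u
  | eqn {Γ : Ctx Sg.Srt} {τ : Sg.Srt} (M N : Term Sg Γ τ) : Assertion L Sg
  | seq {Γ : Ctx Sg.Srt} (Φ : List (Formula L Sg Γ)) (ψ : Formula L Sg Γ) : Assertion L Sg

/-- The complete lattice of `Sg`-theories, ordered by inclusion. -/
abbrev Theory (L : FOLanguage.{u}) (Sg : Signature.{u}) : Type u := Set (Assertion L Sg)

/-- The instances (set of premises, conclusion) of the rules of equational logic.
In `subst`, the injective renaming `ρ` expresses that the variables of `Θ` are, with their sorts,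
among those of `Γ, Δ`. -/
inductive EqRule (L : FOLanguage.{u}) (Sg : Signature.{u}) : Theory L Sg → Assertion L Sg → Prop
  | refl {Γ : Ctx Sg.Srt} {σ : Sg.Srt} (M : Term Sg Γ σ) : EqRule L Sg ∅ (.eqn M M)
  | symm {Γ : Ctx Sg.Srt} {σ : Sg.Srt} (M N : Term Sg Γ σ) :
      EqRule L Sg {.eqn M N} (.eqn N M)
  | trans {Γ : Ctx Sg.Srt} {σ : Sg.Srt} (M N K : Term Sg Γ σ) :
      EqRule L Sg {.eqn M N, .eqn N K} (.eqn M K)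
  | subst {Γ Δ Θ : Ctx Sg.Srt} {σ τ : Sg.Srt} (ρ : Ren Θ (Δ ++ Γ))
      (hρ : ∀ υ : Sg.Srt, Function.Injective (ρ υ)) (M M₁ : Term Sg Θ σ)
      (N N₁ : Term Sg (Δ ++ σ :: Γ) τ) :
      EqRule L Sg {.eqn M M₁, .eqn N N₁}
        (.eqn (N.subst (Subst.single Γ Δ (M.rename ρ)))
          (N₁.subst (Subst.single Γ Δ (M₁.rename ρ))))

/-- The instances (set of premises, conclusion) of the rules of the minimal logic: the rules of
equational logic and the sequent rules.  `φ ⊣⊢ ψ` as a premise stands for the two sequents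
`φ ⊢ ψ` and `ψ ⊢ φ`, and a double line for a rule and its inverse. -/
inductive MinRule (L : FOLanguage.{u}) (Sg : Signature.{u}) : Theory L Sg → Assertion L Sg → Prop
  | equational {A : Theory L Sg} {a : Assertion L Sg} (r : EqRule L Sg A a) : MinRule L Sg A a
  | ax {Γ : Ctx Sg.Srt} (φ : Formula L Sg Γ) : MinRule L Sg ∅ (.seq [φ] φ)
  | cut {Γ : Ctx Sg.Srt} (φ ψ θ : Formula L Sg Γ) :
      MinRule L Sg {.seq [φ] ψ, .seq [ψ] θ} (.seq [φ] θ)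
  | cwk {Γ : Ctx Sg.Srt} (σ : Sg.Srt) (Φ : List (Formula L Sg Γ)) (ψ : Formula L Sg Γ) :
      MinRule L Sg {.seq Φ ψ} (.seq (Φ.map (Formula.weaken σ)) (ψ.weaken σ))
  | sub {Γ Δ Θ : Ctx Sg.Srt} {σ : Sg.Srt} (ρ : Ren Θ (Δ ++ Γ))
      (hρ : ∀ υ : Sg.Srt, Function.Injective (ρ υ)) (M M₁ : Term Sg Θ σ)
      (Φ : List (Formula L Sg (Δ ++ σ :: Γ))) (ψ : Formula L Sg (Δ ++ σ :: Γ)) :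
      MinRule L Sg {.eqn M M₁, .seq Φ ψ}
        (.seq (Φ.map (Formula.subst (Subst.single Γ Δ (M.rename ρ))))
          (ψ.subst (Subst.single Γ Δ (M₁.rename ρ))))
  | quantCong {Γ : Ctx Sg.Srt} (Q : L.Quant) (σ : Sg.Srt) (φ ψ : Formula L Sg (σ :: Γ)) :
      MinRule L Sg {.seq [φ] ψ, .seq [ψ] φ} (.seq [.quant Q σ φ] (.quant Q σ ψ))
  | connCong {Γ : Ctx Sg.Srt} {n : ℕ} (k : L.Conn n) (φ ψ : Fin n → Formula L Sg Γ) :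
      MinRule L Sg
        (Set.range (fun i => Assertion.seq [φ i] (ψ i)) ∪
          Set.range (fun i => Assertion.seq [ψ i] (φ i)))
        (.seq [.conn k φ] (.conn k ψ))
  | tensorRef {Γ : Ctx Sg.Srt} (Φ Ψ : List (Formula L Sg Γ)) (α β θ : Formula L Sg Γ) :
      MinRule L Sg {.seq (Φ ++ α :: β :: Ψ) θ} (.seq (Φ ++ α.tensor β :: Ψ) θ)
  | tensorRefInv {Γ : Ctx Sg.Srt} (Φ Ψ : List (Formula L Sg Γ)) (α β θ : Formula L Sg Γ) :
      MinRule L Sg {.seq (Φ ++ α.tensor β :: Ψ) θ} (.seq (Φ ++ α :: β :: Ψ) θ)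
  | unitRef {Γ : Ctx Sg.Srt} (Φ Ψ : List (Formula L Sg Γ)) (φ : Formula L Sg Γ) :
      MinRule L Sg {.seq (Φ ++ .unit :: Ψ) φ} (.seq (Φ ++ Ψ) φ)
  | unitRefInv {Γ : Ctx Sg.Srt} (Φ Ψ : List (Formula L Sg Γ)) (φ : Formula L Sg Γ) :
      MinRule L Sg {.seq (Φ ++ Ψ) φ} (.seq (Φ ++ .unit :: Ψ) φ)

/-- A logic: a closure operator on the lattice of `Sg`-theories for each signature `Sg`, whose
closed theories are closed under the rules of equational logic. -/
structure Logic (L : FOLanguage.{u}) : Type (u + 1) where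
  cl : ∀ Sg : Signature.{u}, ClosureOperator (Theory L Sg)
  equational : ∀ (Sg : Signature.{u}) (T A : Theory L Sg) (a : Assertion L Sg),
    EqRule L Sg A a → A ⊆ cl Sg T → a ∈ cl Sg T

/-- `T ⊢ U` in the logic `𝓛`. -/
def Logic.Derives {L : FOLanguage.{u}} (𝓛 : Logic L) {Sg : Signature.{u}} (T U : Theory L Sg) :
    Prop :=
  U ⊆ 𝓛.cl Sg T

/-- `T` is an `𝓛`-theory, i.e. it is closed under derivability in `𝓛`. -/
def Logic.IsTheory {L : FOLanguage.{u}} (𝓛 : Logic L) {Sg : Signature.{u}} (T : Theory L Sg) :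
    Prop :=
  𝓛.cl Sg T = T

/-- Derivations from `T` by the rules of the minimal logic. -/
inductive MinDerivable {L : FOLanguage.{u}} {Sg : Signature.{u}} (T : Theory L Sg) :
    Assertion L Sg → Prop
  | hyp {a : Assertion L Sg} (ha : a ∈ T) : MinDerivable T a
  | rule {A : Theory L Sg} {a : Assertion L Sg} (r : MinRule L Sg A a)
      (ih : ∀ b ∈ A, MinDerivable T b) : MinDerivable T a

theorem MinDerivable.trans {L : FOLanguage.{u}} {Sg : Signature.{u}} {T U : Theory L Sg}
    (hTU : ∀ b ∈ T, MinDerivable U b) {a : Assertion L Sg} (ha : MinDerivable T a) :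
    MinDerivable U a := by
  induction ha with
  | hyp ha => exact hTU _ ha
  | rule r _ ih => exact .rule r ih

/-- The minimal logic `𝓛ᵐ`. -/
def minimalLogic (L : FOLanguage.{u}) : Logic L where
  cl _ := ClosureOperator.mk' (fun T => {a | MinDerivable T a})
    (fun _ _ hTU _ ha => MinDerivable.trans (fun _ hb => .hyp (hTU hb)) ha)
    (fun _ _ ha => .hyp ha)
    (fun _ _ ha => MinDerivable.trans (fun _ hb => hb) ha)
  equational _ _ _ _ r hA := .rule (.equational r) hA

/-! ## Prop-categories -/

/-- A prop-category `(C, P)`: a category with designated finite products (a designated terminal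
object `𝟙_ C` and designated binary products `b ⊗ c`) and a contravariant functor to posets. -/
structure PropCategory : Type (max (o + 1) (h + 1) (p + 1)) where
  C : Type o
  [cat : Category.{h} C]
  [prod : CartesianMonoidalCategory C]
  P : Cᵒᵖ ⥤ PartOrd.{p}

attribute [instance] PropCategory.cat PropCategory.prod

/-- The poset `P(c)`. -/
abbrev PropCategory.Pred (X : PropCategory.{o, h, p}) (c : X.C) : Type p := X.P.obj (op c)

/-- The map `P(f) : P(d) → P(c)` for `f : c ⟶ d`. -/
def PropCategory.pull (X : PropCategory.{o, h, p}) {c d : X.C} (f : c ⟶ d) (a : X.Pred d) :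
    X.Pred c :=
  (X.P.map f.op).hom a

/-- A prop-category with the operations that interpret connectives, equality and quantifiers,
not yet subject to any conditions. -/
structure FAData (L : FOLanguage.{u}) : Type (max u (o + 1) (h + 1) (p + 1)) extends
    PropCategory.{o, h, p} where
  conn : ∀ (c : C) {n : ℕ}, L.Conn n → (Fin n → toPropCategory.Pred c) → toPropCategory.Pred c
  eqPred : ∀ c : C, toPropCategory.Pred (c ⊗ c)
  quant : ∀ (_ : L.Quant) (b c : C), toPropCategory.Pred (b ⊗ c) → toPropCategory.Pred b

/-- The element `e` of `P(c)`. -/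
def FAData.unit {L : FOLanguage.{u}} (X : FAData.{u, o, h, p} L) (c : X.C) : X.Pred c :=
  X.conn c L.unit Fin.elim0

/-- The operation `⊗` of `P(c)`. -/
def FAData.tensor {L : FOLanguage.{u}} (X : FAData.{u, o, h, p} L) {c : X.C} (a b : X.Pred c) :
    X.Pred c :=
  X.conn c L.tensor ![a, b]

/-- The conditions for a prop-category with operations to be an object of `FA`. -/
structure FAData.IsFA {L : FOLanguage.{u}} (X : FAData.{u, o, h, p} L) : Prop where
  /-- the maps `P(f)` are homomorphisms -/
  pull_conn : ∀ {c d : X.C} (f : c ⟶ d) {n : ℕ} (k : L.Conn n) (a : Fin n → X.Pred d),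
    X.pull f (X.conn d k a) = X.conn c k fun i => X.pull f (a i)
  /-- the quantifier maps are natural in their first index -/
  pull_quant : ∀ (Q : L.Quant) {b d : X.C} (c : X.C) (f : b ⟶ d) (a : X.Pred (d ⊗ c)),
    X.pull f (X.quant Q d c a) = X.quant Q b c (X.pull (f ▷ c) a)
  /-- each `P(c)` is a monoid -/
  tensor_assoc : ∀ (c : X.C) (x y z : X.Pred c),
    X.tensor (X.tensor x y) z = X.tensor x (X.tensor y z)
  unit_tensor : ∀ (c : X.C) (x : X.Pred c), X.tensor (X.unit c) x = x
  tensor_unit : ∀ (c : X.C) (x : X.Pred c), X.tensor x (X.unit c) = x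
  /-- quantification over the designated terminal object and over designated products -/
  quant_one : ∀ (Q : L.Quant) (b : X.C) (a : X.Pred b),
    X.quant Q b (𝟙_ X.C) (X.pull (fst b (𝟙_ X.C)) a) = a
  quant_prod : ∀ (Q : L.Quant) (b c d : X.C) (a : X.Pred ((b ⊗ c) ⊗ d)),
    X.quant Q b (c ⊗ d) (X.pull (α_ b c d).inv a) = X.quant Q b c (X.quant Q (b ⊗ c) d a)
  /-- equality on the designated terminal object and on designated products -/
  eq_one : X.eqPred (𝟙_ X.C) = X.unit (𝟙_ X.C ⊗ 𝟙_ X.C)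
  eq_prod : ∀ c d : X.C, X.eqPred (c ⊗ d) =
    X.tensor
      (X.pull (lift (fst (c ⊗ d) (c ⊗ d) ≫ fst c d) (snd (c ⊗ d) (c ⊗ d) ≫ fst c d))
        (X.eqPred c))
      (X.pull (lift (fst (c ⊗ d) (c ⊗ d) ≫ snd c d) (snd (c ⊗ d) (c ⊗ d) ≫ snd c d))
        (X.eqPred d))

/-! ## Structures and satisfaction -/

/-- The product of the interpretations of the sorts of a context. -/
def ctxObj {C : Type o} [Category.{h} C] [CartesianMonoidalCategory C] {S : Type u} (F : S → C) :
    Ctx S → C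
  | [] => 𝟙_ C
  | σ :: Γ => ctxObj F Γ ⊗ F σ

/-- The projections from the product of a context. -/
def ctxProj {C : Type o} [Category.{h} C] [CartesianMonoidalCategory C] {S : Type u} (F : S → C) :
    {Γ : Ctx S} → {σ : S} → Var Γ σ → (ctxObj F Γ ⟶ F σ)
  | σ :: Γ, _, .zero => snd (ctxObj F Γ) (F σ)
  | σ :: Γ, _, .succ v => fst (ctxObj F Γ) (F σ) ≫ ctxProj F v

/-- The morphism into the product of a context with given components. -/
def ctxTuple {C : Type o} [Category.{h} C] [CartesianMonoidalCategory C] {S : Type u} (F : S → C)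
    {c : C} : {Γ : Ctx S} → (∀ σ : S, Var Γ σ → (c ⟶ F σ)) → (c ⟶ ctxObj F Γ)
  | [], _ => toUnit c
  | _ :: _, g => lift (ctxTuple F fun _ v => g _ (.succ v)) (g _ .zero)

/-- An `Sg`-structure in a prop-category. -/
structure Struc {L : FOLanguage.{u}} (Sg : Signature.{u}) (X : FAData.{u, o, h, p} L) :
    Type (max u o h p) where
  obj : Sg.Srt → X.C
  func : ∀ f : Sg.Func, ctxObj obj (Sg.dom f) ⟶ obj (Sg.cod f)
  rel : ∀ R : Sg.Rel, X.Pred (ctxObj obj (Sg.arity R))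

/-- The interpretation of a context. -/
abbrev Struc.ctx {L : FOLanguage.{u}} {Sg : Signature.{u}} {X : FAData.{u, o, h, p} L}
    (S : Struc Sg X) (Γ : Ctx Sg.Srt) : X.C :=
  ctxObj S.obj Γ

/-- The interpretation of a term-in-context. -/
def Struc.term {L : FOLanguage.{u}} {Sg : Signature.{u}} {X : FAData.{u, o, h, p} L}
    (S : Struc Sg X) {Γ : Ctx Sg.Srt} : {τ : Sg.Srt} → Term Sg Γ τ → (S.ctx Γ ⟶ S.obj τ)
  | _, .var v => ctxProj S.obj v
  | _, .app f args => ctxTuple S.obj (fun σ v => S.term (args σ v)) ≫ S.func f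

/-- The interpretation of a formula-in-context. -/
def Struc.formula {L : FOLanguage.{u}} {Sg : Signature.{u}} {X : FAData.{u, o, h, p} L}
    (S : Struc Sg X) : {Γ : Ctx Sg.Srt} → Formula L Sg Γ → X.Pred (S.ctx Γ)
  | _, .rel R args => X.pull (ctxTuple S.obj fun σ v => S.term (args σ v)) (S.rel R)
  | _, .eq (σ := σ) M N => X.pull (lift (S.term M) (S.term N)) (X.eqPred (S.obj σ))
  | Γ, .conn k φ => X.conn (S.ctx Γ) k fun i => S.formula (φ i)
  | Γ, .quant Q σ φ => X.quant Q (S.ctx Γ) (S.obj σ) (S.formula φ)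

/-- The product `a₁ ⊗ ⋯ ⊗ aₙ` of a list in `P(c)`, which is `e` for the empty list. -/
def FAData.tensorList {L : FOLanguage.{u}} (X : FAData.{u, o, h, p} L) {c : X.C}
    (l : List (X.Pred c)) : X.Pred c :=
  l.foldr X.tensor (X.unit c)

/-- Satisfaction of an assertion in a structure. -/
def Struc.Sat {L : FOLanguage.{u}} {Sg : Signature.{u}} {X : FAData.{u, o, h, p} L}
    (S : Struc Sg X) : Assertion L Sg → Prop
  | .eqn M N => S.term M = S.term N
  | .seq Φ ψ => X.tensorList (Φ.map S.formula) ≤ S.formula ψ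

/-- The theory `Th(S)` of a structure. -/
def Struc.th {L : FOLanguage.{u}} {Sg : Signature.{u}} {X : FAData.{u, o, h, p} L}
    (S : Struc Sg X) : Theory L Sg :=
  {a | S.Sat a}

/-- `T ⊨ U` over the class `K`: every model of `T` in a member of `K` is a model of `U`. -/
def Entails {L : FOLanguage.{u}} (K : Set (FAData.{u, o, h, p} L)) {Sg : Signature.{u}}
    (T U : Theory L Sg) : Prop :=
  ∀ X ∈ K, ∀ S : Struc Sg X, T ⊆ S.th → U ⊆ S.th

/-! ## Classifying prop-categories -/

/-- Componentwise equality of substitutions modulo the equations in `T`. -/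
def Subst.Equiv {L : FOLanguage.{u}} {Sg : Signature.{u}} (T : Theory L Sg) {Γ Δ : Ctx Sg.Srt}
    (γ δ : Subst Sg Γ Δ) : Prop :=
  ∀ (σ : Sg.Srt) (v : Var Γ σ), Assertion.eqn (γ σ v) (δ σ v) ∈ T

/-- The construction of the classifying prop-category of `T` is well defined: provable equality of
terms is an equivalence relation compatible with substitution, `φ ⊢ ψ [Γ] ∈ T` is a preorder, and
substitution, connectives and quantifiers are well defined on the classes of interderivable
formulas, substitution being monotone. -/
structure WellDefined {L : FOLanguage.{u}} {Sg : Signature.{u}} (T : Theory L Sg) : Prop where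
  eq_refl : ∀ {Γ : Ctx Sg.Srt} {σ : Sg.Srt} (M : Term Sg Γ σ), Assertion.eqn M M ∈ T
  eq_symm : ∀ {Γ : Ctx Sg.Srt} {σ : Sg.Srt} (M N : Term Sg Γ σ),
    Assertion.eqn M N ∈ T → Assertion.eqn N M ∈ T
  eq_trans : ∀ {Γ : Ctx Sg.Srt} {σ : Sg.Srt} (M N K : Term Sg Γ σ),
    Assertion.eqn M N ∈ T → Assertion.eqn N K ∈ T → Assertion.eqn M K ∈ T
  eq_subst : ∀ {Γ Δ : Ctx Sg.Srt} {σ : Sg.Srt} (γ δ : Subst Sg Γ Δ) (M N : Term Sg Γ σ),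
    Subst.Equiv T γ δ → Assertion.eqn M N ∈ T → Assertion.eqn (M.subst γ) (N.subst δ) ∈ T
  le_refl : ∀ {Γ : Ctx Sg.Srt} (φ : Formula L Sg Γ), Assertion.seq [φ] φ ∈ T
  le_trans : ∀ {Γ : Ctx Sg.Srt} (φ ψ θ : Formula L Sg Γ),
    Assertion.seq [φ] ψ ∈ T → Assertion.seq [ψ] θ ∈ T → Assertion.seq [φ] θ ∈ T
  le_subst : ∀ {Γ Δ : Ctx Sg.Srt} (γ : Subst Sg Γ Δ) (φ ψ : Formula L Sg Γ),
    Assertion.seq [φ] ψ ∈ T → Assertion.seq [φ.subst γ] (ψ.subst γ) ∈ T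
  subst_congr : ∀ {Γ Δ : Ctx Sg.Srt} (γ δ : Subst Sg Γ Δ) (φ : Formula L Sg Γ),
    Subst.Equiv T γ δ → Assertion.seq [φ.subst γ] (φ.subst δ) ∈ T
  conn_congr : ∀ {Γ : Ctx Sg.Srt} {n : ℕ} (k : L.Conn n) (φ ψ : Fin n → Formula L Sg Γ),
    (∀ i, Assertion.seq [φ i] (ψ i) ∈ T) → (∀ i, Assertion.seq [ψ i] (φ i) ∈ T) →
      Assertion.seq [.conn k φ] (.conn k ψ) ∈ T
  quant_congr : ∀ {Γ : Ctx Sg.Srt} (Q : L.Quant) (σ : Sg.Srt) (φ ψ : Formula L Sg (σ :: Γ)),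
    Assertion.seq [φ] ψ ∈ T → Assertion.seq [ψ] φ ∈ T →
      Assertion.seq [.quant Q σ φ] (.quant Q σ ψ) ∈ T

/-- `γ ∼ δ` for substitutions. -/
def WellDefined.substSetoid {L : FOLanguage.{u}} {Sg : Signature.{u}} {T : Theory L Sg}
    (hT : WellDefined T) (Γ Δ : Ctx Sg.Srt) : Setoid (Subst Sg Γ Δ) where
  r := Subst.Equiv T
  iseqv :=
    { refl := fun _ _ _ => hT.eq_refl _
      symm := fun hγ σ v => hT.eq_symm _ _ (hγ σ v)
      trans := fun hγ hδ σ v => hT.eq_trans _ _ _ (hγ σ v) (hδ σ v) }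

/-- `φ ∼ ψ` for formulas: both `φ ⊢ ψ [Γ]` and `ψ ⊢ φ [Γ]` are in `T`. -/
def WellDefined.formulaSetoid {L : FOLanguage.{u}} {Sg : Signature.{u}} {T : Theory L Sg}
    (hT : WellDefined T) (Γ : Ctx Sg.Srt) : Setoid (Formula L Sg Γ) where
  r φ ψ := Assertion.seq [φ] ψ ∈ T ∧ Assertion.seq [ψ] φ ∈ T
  iseqv :=
    { refl := fun _ => ⟨hT.le_refl _, hT.le_refl _⟩
      symm := fun hφ => ⟨hφ.2, hφ.1⟩
      trans := fun hφ hψ => ⟨hT.le_trans _ _ _ hφ.1 hψ.1, hT.le_trans _ _ _ hψ.2 hφ.2⟩ }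

/-- The objects of the category `C_T`: contexts. -/
structure ClassObj {L : FOLanguage.{u}} {Sg : Signature.{u}} {T : Theory L Sg}
    (hT : WellDefined T) : Type u where
  ctx : Ctx Sg.Srt

/-- The category `C_T`.  A morphism `Δ ⟶ Γ` is a sequence of terms in context `Δ`, one for each
variable of `Γ`, modulo the equations in `T`; composition is substitution. -/
instance {L : FOLanguage.{u}} {Sg : Signature.{u}} {T : Theory L Sg} (hT : WellDefined T) :
    Category.{u} (ClassObj hT) where
  Hom Δ Γ := Quotient (hT.substSetoid Γ.ctx Δ.ctx)
  id Γ := Quotient.mk _ fun _ v => .var v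
  comp {Θ Δ Γ} f g := Quotient.map₂
    (sa := hT.substSetoid Δ.ctx Θ.ctx) (sb := hT.substSetoid Γ.ctx Δ.ctx)
    (sc := hT.substSetoid Γ.ctx Θ.ctx)
    (fun δ γ σ v => (γ σ v).subst δ)
    (fun _ _ hδ _ _ hγ σ v => hT.eq_subst _ _ _ _ hδ (hγ σ v)) f g
  id_comp {Δ Γ} f := by
    induction f using Quotient.inductionOn
    exact congrArg (Quotient.mk _) (funext fun σ => funext fun v => Term.subst_var _)
  comp_id {Δ Γ} f := by
    induction f using Quotient.inductionOn
    rfl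
  assoc {W X Y Z} f g k := by
    induction f using Quotient.inductionOn
    induction g using Quotient.inductionOn
    induction k using Quotient.inductionOn
    exact congrArg (Quotient.mk _)
      (funext fun σ => funext fun v => (Term.subst_subst _ _ _).symm)

/-- The morphism of `C_T` represented by a substitution. -/
def WellDefined.hom {L : FOLanguage.{u}} {Sg : Signature.{u}} {T : Theory L Sg}
    (hT : WellDefined T) {Γ Δ : Ctx Sg.Srt} (γ : Subst Sg Γ Δ) :
    (ClassObj.mk Δ : ClassObj hT) ⟶ ClassObj.mk Γ :=
  Quotient.mk (hT.substSetoid Γ Δ) γ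

/-- The empty context is a terminal object of `C_T`. -/
def WellDefined.terminalCone {L : FOLanguage.{u}} {Sg : Signature.{u}} {T : Theory L Sg}
    (hT : WellDefined T) : Limits.LimitCone (Functor.empty.{0} (ClassObj hT)) where
  cone := Limits.asEmptyCone (ClassObj.mk [])
  isLimit := Limits.IsTerminal.ofUniqueHom (Y := ClassObj.mk [])
    (fun _ => hT.hom fun _ v => nomatch v)
    (fun _ f => by
      induction f using Quotient.inductionOn
      exact congrArg (Quotient.mk _) (funext fun σ => funext fun v => nomatch v))

/-- The concatenation of contexts is their product in `C_T`. -/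
def WellDefined.productCone {L : FOLanguage.{u}} {Sg : Signature.{u}} {T : Theory L Sg}
    (hT : WellDefined T) (Γ Δ : ClassObj hT) : Limits.LimitCone (Limits.pair Γ Δ) where
  cone := Limits.BinaryFan.mk (P := ClassObj.mk (Δ.ctx ++ Γ.ctx))
    (hT.hom fun _ v => .var (v.inl Δ.ctx)) (hT.hom fun _ v => .var (v.inr Γ.ctx))
  isLimit := Limits.BinaryFan.IsLimit.mk _
    (fun {Θ} f g => Quotient.map₂
      (sa := hT.substSetoid Γ.ctx Θ.ctx) (sb := hT.substSetoid Δ.ctx Θ.ctx)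
      (sc := hT.substSetoid (Δ.ctx ++ Γ.ctx) Θ.ctx)
      (fun γ δ => γ.append δ)
      (fun γ γ₁ hγ δ δ₁ hδ σ v => by
        rcases v.append_cases with ⟨w, rfl⟩ | ⟨w, rfl⟩
        · simpa only [Subst.append_inl] using hγ σ w
        · simpa only [Subst.append_inr] using hδ σ w) f g)
    (fun {Θ} f g => by
      induction f using Quotient.inductionOn
      induction g using Quotient.inductionOn
      exact congrArg (Quotient.mk _)
        (funext fun σ => funext fun v => Subst.append_inl _ _ v))
    (fun {Θ} f g => by
      induction f using Quotient.inductionOn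
      induction g using Quotient.inductionOn
      exact congrArg (Quotient.mk _)
        (funext fun σ => funext fun v => Subst.append_inr _ _ v))
    (fun {Θ} f g m hf hg => by
      subst hf hg
      induction m using Quotient.inductionOn
      rename_i m
      exact congrArg (Quotient.mk (hT.substSetoid (Δ.ctx ++ Γ.ctx) Θ.ctx))
        (Subst.append_eta (Γ := Γ.ctx) (Δ := Δ.ctx) m).symm)

instance {L : FOLanguage.{u}} {Sg : Signature.{u}} {T : Theory L Sg} (hT : WellDefined T) :
    CartesianMonoidalCategory (ClassObj hT) :=
  .ofChosenFiniteProducts hT.terminalCone hT.productCone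

/-- The order of `P_T(Γ)`: `[φ] ≤ [ψ]` if and only if `φ ⊢ ψ [Γ] ∈ T`. -/
instance {L : FOLanguage.{u}} {Sg : Signature.{u}} {T : Theory L Sg} (hT : WellDefined T)
    (Γ : Ctx Sg.Srt) : PartialOrder (Quotient (hT.formulaSetoid Γ)) where
  le := Quotient.lift₂ (fun φ ψ => Assertion.seq [φ] ψ ∈ T)
    (fun _ _ _ _ hφ hψ => propext
      ⟨fun hl => hT.le_trans _ _ _ hφ.2 (hT.le_trans _ _ _ hl hψ.1),
        fun hl => hT.le_trans _ _ _ hφ.1 (hT.le_trans _ _ _ hl hψ.2)⟩)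
  le_refl a := by
    induction a using Quotient.inductionOn
    exact hT.le_refl _
  le_trans a b c hab hbc := by
    induction a using Quotient.inductionOn
    induction b using Quotient.inductionOn
    induction c using Quotient.inductionOn
    exact hT.le_trans _ _ _ hab hbc
  le_antisymm a b hab hba := by
    induction a using Quotient.inductionOn
    induction b using Quotient.inductionOn
    exact Quotient.sound ⟨hab, hba⟩

/-- Substitution of a class of substitutions in a class of formulas. -/
def WellDefined.substClass {L : FOLanguage.{u}} {Sg : Signature.{u}} {T : Theory L Sg}
    (hT : WellDefined T) {Γ Δ : Ctx Sg.Srt} (γ : Quotient (hT.substSetoid Γ Δ))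
    (a : Quotient (hT.formulaSetoid Γ)) : Quotient (hT.formulaSetoid Δ) :=
  Quotient.map₂ (sa := hT.substSetoid Γ Δ) (sb := hT.formulaSetoid Γ)
    (sc := hT.formulaSetoid Δ) (fun γ φ => φ.subst γ)
    (fun _ _ hγ _ _ hφ =>
      ⟨hT.le_trans _ _ _ (hT.le_subst _ _ _ hφ.1) (hT.subst_congr _ _ _ hγ),
        hT.le_trans _ _ _ (hT.le_subst _ _ _ hφ.2)
          (hT.subst_congr _ _ _ ((hT.substSetoid Γ Δ).symm hγ))⟩) γ a

/-- The functor `P_T`. -/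
def WellDefined.functor {L : FOLanguage.{u}} {Sg : Signature.{u}} {T : Theory L Sg}
    (hT : WellDefined T) : (ClassObj hT)ᵒᵖ ⥤ PartOrd.{u} where
  obj Γ := PartOrd.of (Quotient (hT.formulaSetoid Γ.unop.ctx))
  map f := PartOrd.ofHom
    { toFun := fun a => hT.substClass f.unop a
      monotone' := fun a b hab => by
        obtain ⟨γ, hγ⟩ := Quotient.exists_rep f.unop
        rw [← hγ]
        induction a using Quotient.inductionOn
        induction b using Quotient.inductionOn
        exact hT.le_subst _ _ _ hab }
  map_id Γ := by
    ext a
    induction a using Quotient.inductionOn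
    exact congrArg (Quotient.mk _) (Formula.subst_var _)
  map_comp f g := by
    ext a
    change hT.substClass (g.unop ≫ f.unop) a = hT.substClass g.unop (hT.substClass f.unop a)
    generalize f.unop = f₁
    generalize g.unop = g₁
    induction f₁ using Quotient.inductionOn
    induction g₁ using Quotient.inductionOn
    induction a using Quotient.inductionOn
    exact congrArg (Quotient.mk _) (Formula.subst_subst _ _ _).symm

/-- The conjunction `x₁ = y₁ ⊗ ⋯ ⊗ xₙ = yₙ` over the variables of a context; it starts from `e`. -/
def eqFormula {L : FOLanguage.{u}} {Sg : Signature.{u}} {Θ : Ctx Sg.Srt} :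
    {Γ : Ctx Sg.Srt} → Subst Sg Γ Θ → Subst Sg Γ Θ → Formula L Sg Θ
  | [], _, _ => .unit
  | _ :: _, γ, δ =>
    (eqFormula (fun _ v => γ _ (.succ v)) (fun _ v => δ _ (.succ v))).tensor
      (.eq (γ _ .zero) (δ _ .zero))

/-- Quantification over all the variables of `Δ`, on classes of formulas in context `Γ, Δ`; the
innermost quantifier binds the last variable of `Δ`. -/
def WellDefined.quantClass {L : FOLanguage.{u}} {Sg : Signature.{u}} {T : Theory L Sg}
    (hT : WellDefined T) (Q : L.Quant) (Γ : Ctx Sg.Srt) :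
    (Δ : Ctx Sg.Srt) → Quotient (hT.formulaSetoid (Δ ++ Γ)) → Quotient (hT.formulaSetoid Γ)
  | [], a => a
  | σ :: Δ, a => hT.quantClass Q Γ Δ <|
      Quotient.map (sa := hT.formulaSetoid (σ :: (Δ ++ Γ))) (sb := hT.formulaSetoid (Δ ++ Γ))
        (Formula.quant Q σ)
        (fun _ _ hφ => ⟨hT.quant_congr _ _ _ _ hφ.1 hφ.2, hT.quant_congr _ _ _ _ hφ.2 hφ.1⟩) a

/-- The classifying prop-category `(C_T, P_T)`. -/
noncomputable def classifying {L : FOLanguage.{u}} {Sg : Signature.{u}} (T : Theory L Sg)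
    (hT : WellDefined T) : FAData.{u, u, u, u} L where
  C := ClassObj hT
  P := hT.functor
  conn Γ _ k a := Quotient.mk (hT.formulaSetoid Γ.ctx)
    (.conn k fun i => Quotient.out (s := hT.formulaSetoid Γ.ctx) (a i))
  eqPred Γ := Quotient.mk (hT.formulaSetoid (Γ.ctx ++ Γ.ctx))
    (eqFormula (fun _ v => .var (v.inl Γ.ctx)) (fun _ v => .var (v.inr Γ.ctx)))
  quant Q Γ Δ a := hT.quantClass Q Γ.ctx Δ.ctx a

/-- A logic is adequate if for each of its theories `T` the classifying prop-category can be
constructed, is in `FA`, and contains a generic model of `T`. -/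
def Logic.Adequate {L : FOLanguage.{u}} (𝓛 : Logic L) : Prop :=
  ∀ (Sg : Signature.{u}) (T : Theory L Sg), 𝓛.IsTheory T →
    ∃ hT : WellDefined T, (classifying T hT).IsFA ∧
      ∃ G : Struc Sg (classifying T hT), G.th = T

end FibLogic

namespace FibLogic

/-! ## Variables and substitutions -/

/-! Both directions rest on `MinClosed`, closure of a set of assertions under the minimal rules.

Soundness: `Th(S)` is `MinClosed` for every structure `S` in an object of `FA`
(`Struc.th_minClosed`), hence contains whatever is derivable from a subset of it. Substitution is
interpreted by composition for terms and by `P(f)` for formulas (`Struc.term_subst`,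
`Struc.formula_subst`). The refinement rules preserve the interpretation of the left-hand side by
the monoid laws, and the congruence rules hold because interderivable formulas are interpreted by
equal elements.

Adequacy: the rules replace one variable at a time, whereas composition in `C_T` is simultaneous
substitution. The bridge is `Subst.Equiv.simultaneous`: weaken from `Γ` to `Γ, Θ`, so that the terms
to be substituted use only the fresh variables `Θ`, then eliminate the variables of `Γ` in turn.
With this the classifying prop-category is well defined; the refinement rules make each `P_T(Γ)` a
monoid, and the remaining conditions are syntactic identities (`MinClosed.isFA_classifying`). The
generic model sends a sort to the one-variable context of that sort, and interprets a term or
formula as its own class up to renaming of the context (`WellDefined.generic_term`,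
`MinClosed.generic_formula`). Hence its theory is `T` (`MinClosed.generic_th`).

Completeness and the corollary both evaluate at the generic model of the closure of `T`: it is a
model of `T`, and whatever it satisfies lies in that closure. -/

theorem Var.inl_injective {S : Type u} {Γ : Ctx S} (Δ : Ctx S) (τ : S) :
    Function.Injective (Var.inl Δ : Var Γ τ → Var (Δ ++ Γ) τ) := by
  induction Δ with
  | nil => exact fun _ _ hv => hv
  | cons σ Δ ih => exact fun v w hv => ih (Var.succ.inj hv)

theorem Var.inr_injective {S : Type u} (Γ : Ctx S) {Δ : Ctx S} (τ : S) :
    Function.Injective (Var.inr Γ : Var Δ τ → Var (Δ ++ Γ) τ) := by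
  intro v w hv
  induction v with
  | zero =>
    cases w with
    | zero => rfl
    | succ w => cases hv
  | succ v ih =>
    cases w with
    | zero => cases hv
    | succ w => exact congrArg Var.succ (ih (Var.succ.inj hv))

theorem Subst.single_inl_zero {Sg : Signature.{u}} (Γ Δ : Ctx Sg.Srt) {σ : Sg.Srt}
    (M : Term Sg (Δ ++ Γ) σ) :
    Subst.single Γ Δ M σ (Var.inl Δ .zero) = M := by
  -- `Subst.insert` recurses on `Δ` with a fixed target and a shrinking `γ`, so the induction needs
  -- a target independent of `Δ` and an arbitrary `γ`.
  suffices H : ∀ {Θ : Ctx Sg.Srt} (Δ : Ctx Sg.Srt) (M : Term Sg Θ σ) (γ : Subst Sg (Δ ++ Γ) Θ),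
      Subst.insert M Δ γ σ (Var.inl Δ .zero) = M from H Δ M _
  intro Θ Δ
  induction Δ with
  | nil => exact fun _ _ => rfl
  | cons τ Δ ih => exact fun M γ => ih M _

theorem Subst.single_inl_succ {Sg : Signature.{u}} (Γ Δ : Ctx Sg.Srt) {σ τ : Sg.Srt}
    (M : Term Sg (Δ ++ Γ) σ) (v : Var Γ τ) :
    Subst.single Γ Δ M τ (Var.inl Δ (.succ v)) = .var (v.inl Δ) := by
  suffices H : ∀ {Θ : Ctx Sg.Srt} (Δ : Ctx Sg.Srt) (M : Term Sg Θ σ) (γ : Subst Sg (Δ ++ Γ) Θ),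
      Subst.insert M Δ γ τ (Var.inl Δ (.succ v)) = γ τ (v.inl Δ) from H Δ M _
  intro Θ Δ
  induction Δ with
  | nil => exact fun _ _ => rfl
  | cons τ Δ ih => exact fun M γ => ih M _

theorem Subst.single_inr {Sg : Signature.{u}} (Γ Δ : Ctx Sg.Srt) {σ τ : Sg.Srt}
    (M : Term Sg (Δ ++ Γ) σ) (v : Var Δ τ) :
    Subst.single Γ Δ M τ (v.inr (σ :: Γ)) = .var (v.inr Γ) := by
  suffices H : ∀ {Θ : Ctx Sg.Srt} (M : Term Sg Θ σ) (Δ : Ctx Sg.Srt) (v : Var Δ τ)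
      (γ : Subst Sg (Δ ++ Γ) Θ),
      Subst.insert M Δ γ τ (v.inr (σ :: Γ)) = γ τ (v.inr Γ) from H M Δ v _
  clear v
  intro Θ M Δ v
  induction v with
  | zero => exact fun _ => rfl
  | succ v ih => exact fun γ => ih fun _ w => γ _ (.succ w)

/-- Up to equality of contexts, the substitution `Γ, ∅ → Γ` is the identity. -/
theorem Subst.append_nil_induction {Sg : Signature.{u}} {Θ : Ctx Sg.Srt} (γ : Subst Sg [] Θ)
    (Q : ∀ Ξ : Ctx Sg.Srt, Subst Sg (Θ ++ []) Ξ → Prop) (hQ : Q _ fun _ v => .var v) :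
    Q Θ (Subst.append γ fun _ v => .var v) := by
  -- `Θ ++ []` and `Θ` are not definitionally equal, so the claim is phrased through predicates that
  -- range over the target context as well.
  induction Θ with
  | nil =>
    have : Subst.append γ (fun _ v => .var v) = fun _ v => .var v :=
      funext fun _ => funext fun v => nomatch v
    rw [this]
    exact hQ
  | cons σ Θ ih =>
    -- The head variable is absorbed into the predicate: lifting the substitution for the tail gives
    -- the one for the whole context.
    have := ih (fun _ v => nomatch v) (fun Ξ κ => Q (σ :: Ξ) (κ.lift σ))
      (by rw [Subst.lift_var]; exact hQ)
    convert this using 1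
    funext τ v
    rcases Var.append_cases (Γ := []) v with ⟨w, _⟩ | ⟨w, rfl⟩
    · exact nomatch w
    · rw [Subst.append_inr]
      cases w with
      | zero => rfl
      | succ w =>
        change _ = Term.rename _ (Subst.append _ _ _ (w.inr []))
        rw [Subst.append_inr]
        rfl

/-- A relation between substitutions out of `Γ₀` that is stable under replacing the last variable
of `Γ` in a context `Γ, Θ` by equal terms is stable under simultaneous substitution. -/
theorem Subst.Equiv.simultaneous {L : FOLanguage.{u}} {Sg : Signature.{u}} {T : Theory L Sg}
    {Γ₀ Θ : Ctx Sg.Srt} (P : ∀ Ξ : Ctx Sg.Srt, Subst Sg Γ₀ Ξ → Subst Sg Γ₀ Ξ → Prop)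
    (hP : ∀ {Γ : Ctx Sg.Srt} {σ : Sg.Srt} (M N : Term Sg Θ σ)
      (α β : Subst Sg Γ₀ (Θ ++ σ :: Γ)), Assertion.eqn M N ∈ T → P _ α β →
      P (Θ ++ Γ)
        (fun _ v => (α _ v).subst (Subst.single Γ Θ (M.rename fun _ => Var.inr Γ)))
        (fun _ v => (β _ v).subst (Subst.single Γ Θ (N.rename fun _ => Var.inr Γ))))
    (Γ : Ctx Sg.Srt) (α β : Subst Sg Γ₀ (Θ ++ Γ)) (hαβ : P _ α β) (γ δ : Subst Sg Γ Θ)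
    (hγδ : Subst.Equiv T γ δ) :
    P Θ (fun _ v => (α _ v).subst (γ.append fun _ w => .var w))
      (fun _ v => (β _ v).subst (δ.append fun _ w => .var w)) := by
  induction Γ with
  | nil =>
    have hδ : δ = γ := funext fun _ => funext fun v => nomatch v
    rw [hδ]
    refine Subst.append_nil_induction γ
      (fun Ξ κ => P Ξ (fun _ v => (α _ v).subst κ) (fun _ v => (β _ v).subst κ)) ?_
    simpa only [Term.subst_var] using hαβ
  | cons σ Γ ih =>
    -- Replacing the last variable and then the others agrees with replacing all at once: the
    -- inserted term lives in `Θ`, whose variables the later substitution fixes.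
    have key : ∀ ε : Subst Sg (σ :: Γ) Θ,
        (fun τ v => (Subst.single Γ Θ ((ε σ .zero).rename fun _ => Var.inr Γ) τ v).subst
          (Subst.append (fun _ w => ε _ (.succ w)) fun _ w => .var w)) =
        ε.append fun _ w => .var w := by
      intro ε
      funext τ v
      rcases v.append_cases with ⟨w, rfl⟩ | ⟨w, rfl⟩
      · rw [Subst.append_inl]
        cases w with
        | zero =>
          rw [Subst.single_inl_zero, Term.subst_rename]
          simp only [Subst.append_inr, Term.subst_var]
        | succ w =>
          rw [Subst.single_inl_succ]
          exact Subst.append_inl _ _ w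
      · rw [Subst.append_inr, Subst.single_inr]
        exact Subst.append_inr _ _ w
    have := ih _ _ (hP _ _ α β (hγδ σ .zero) hαβ) (fun _ w => γ _ (.succ w))
      (fun _ w => δ _ (.succ w)) (fun _ w => hγδ _ (.succ w))
    simpa only [Term.subst_subst, key] using this

/-! ## Derived rules of the minimal logic -/

/-- `T` is closed under the rules of the minimal logic. -/
def MinClosed {L : FOLanguage.{u}} {Sg : Signature.{u}} (T : Theory L Sg) : Prop :=
  ∀ ⦃A : Theory L Sg⦄ ⦃a : Assertion L Sg⦄, MinRule L Sg A a → A ⊆ T → a ∈ T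

theorem MinClosed.mem_of_derivable {L : FOLanguage.{u}} {Sg : Signature.{u}} {T U : Theory L Sg}
    (hU : MinClosed U) (hTU : T ⊆ U) {a : Assertion L Sg} (ha : MinDerivable T a) : a ∈ U := by
  induction ha with
  | hyp ha => exact hTU ha
  | rule r _ ih => exact hU r ih

theorem minimalLogic_minClosed {L : FOLanguage.{u}} {Sg : Signature.{u}} {T : Theory L Sg}
    (hT : (minimalLogic L).IsTheory T) : MinClosed T := by
  intro A a r hA
  rw [← hT]
  exact MinDerivable.rule r fun b hb => .hyp (hA hb)

namespace MinClosed

variable {L : FOLanguage.{u}} {Sg : Signature.{u}} {T : Theory L Sg} {Γ Δ Θ : Ctx Sg.Srt}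

theorem eqn_refl (hT : MinClosed T) {σ : Sg.Srt} (M : Term Sg Γ σ) :
    Assertion.eqn M M ∈ T :=
  hT (.equational (.refl M)) (Set.empty_subset _)

theorem eqn_symm (hT : MinClosed T) {σ : Sg.Srt} {M N : Term Sg Γ σ}
    (hMN : Assertion.eqn M N ∈ T) : Assertion.eqn N M ∈ T :=
  hT (.equational (.symm M N)) (Set.singleton_subset_iff.2 hMN)

theorem eqn_trans (hT : MinClosed T) {σ : Sg.Srt} {M N K : Term Sg Γ σ}
    (hMN : Assertion.eqn M N ∈ T) (hNK : Assertion.eqn N K ∈ T) : Assertion.eqn M K ∈ T :=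
  hT (.equational (.trans M N K)) (Set.pair_subset hMN hNK)

/-- Equational logic has no separate weakening rule. Its substitution rule, applied to `x = x`,
supplies one, since the terms put for `x` may come from a smaller context. -/
theorem eqn_rename (hT : MinClosed T) {σ : Sg.Srt} {M N : Term Sg Γ σ} (ρ : Ren Γ Δ)
    (hρ : ∀ υ : Sg.Srt, Function.Injective (ρ υ)) (hMN : Assertion.eqn M N ∈ T) :
    Assertion.eqn (M.rename ρ) (N.rename ρ) ∈ T :=
  hT (.equational (.subst (Γ := Δ) (Δ := []) ρ hρ M N (.var .zero) (.var .zero)))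
    (Set.pair_subset hMN (hT.eqn_refl _))

/-- Weakening to `Γ, Δ` keeps the variables being replaced apart from those of the replacing terms,
so the one-variable rule can be iterated without interference. -/
theorem eqn_subst (hT : MinClosed T) {σ : Sg.Srt} {M N : Term Sg Γ σ} {γ δ : Subst Sg Γ Δ}
    (hγδ : Subst.Equiv T γ δ) (hMN : Assertion.eqn M N ∈ T) :
    Assertion.eqn (M.subst γ) (N.subst δ) ∈ T := by
  have := Subst.Equiv.simultaneous (T := T) (Γ₀ := Γ) (Θ := Δ)
    (fun _ α β => Assertion.eqn (M.subst α) (N.subst β) ∈ T)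
    (fun M₁ N₁ α β h₁ hαβ => by
      have := hT (.equational (.subst _ (fun υ => Var.inr_injective _ υ) _ _ _ _))
        (Set.pair_subset h₁ hαβ)
      simpa only [Term.subst_subst] using this)
    Γ (fun _ v => .var (v.inl Δ)) (fun _ v => .var (v.inl Δ))
    (by
      have := hT.eqn_rename (fun _ v => v.inl Δ) (fun υ => Var.inl_injective Δ υ) hMN
      rw [← Term.subst_var (M.rename _), ← Term.subst_var (N.rename _), Term.subst_rename,
        Term.subst_rename] at this
      exact this) γ δ hγδ
  simpa only [Term.subst, Subst.append_inl] using this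

theorem seq_ax (hT : MinClosed T) (φ : Formula L Sg Γ) : Assertion.seq [φ] φ ∈ T :=
  hT (.ax φ) (Set.empty_subset _)

theorem seq_cut (hT : MinClosed T) {φ ψ θ : Formula L Sg Γ} (hφψ : Assertion.seq [φ] ψ ∈ T)
    (hψθ : Assertion.seq [ψ] θ ∈ T) : Assertion.seq [φ] θ ∈ T :=
  hT (.cut φ ψ θ) (Set.pair_subset hφψ hψθ)

theorem seq_inl (hT : MinClosed T) {Φ : List (Formula L Sg Γ)} {ψ : Formula L Sg Γ}
    (hΦ : Assertion.seq Φ ψ ∈ T) (Δ : Ctx Sg.Srt) :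
    Assertion.seq (Φ.map (Formula.subst fun _ v => .var (v.inl Δ)))
      (ψ.subst fun _ v => .var (v.inl Δ)) ∈ T := by
  induction Δ with
  | nil => simpa only [Var.inl, funext Formula.subst_var, List.map_id'] using hΦ
  | cons σ Δ ih =>
    have := hT (.cwk σ _ _) (Set.singleton_subset_iff.2 ih)
    simp only [List.map_map, Formula.weaken, Function.comp_def, Formula.subst_subst] at this
    exact this

/-- Iterates (Sub) after the weakening `seq_inl`. Since (Sub) already puts different, provably equal
terms on the two sides, this one form gives both monotonicity of substitution and its independence
of representatives. -/
theorem seq_subst (hT : MinClosed T) {Φ : List (Formula L Sg Γ)} {ψ : Formula L Sg Γ}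
    {γ δ : Subst Sg Γ Δ} (hγδ : Subst.Equiv T γ δ) (hΦ : Assertion.seq Φ ψ ∈ T) :
    Assertion.seq (Φ.map (Formula.subst γ)) (ψ.subst δ) ∈ T := by
  have := Subst.Equiv.simultaneous (T := T) (Γ₀ := Γ) (Θ := Δ)
    (fun _ α β => Assertion.seq (Φ.map (Formula.subst α)) (ψ.subst β) ∈ T)
    (fun M₁ N₁ α β h₁ hαβ => by
      have := hT (.sub _ (fun υ => Var.inr_injective _ υ) _ _ _ _)
        (Set.pair_subset h₁ hαβ)
      simpa only [List.map_map, Function.comp_def, Formula.subst_subst] using this)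
    Γ (fun _ v => .var (v.inl Δ)) (fun _ v => .var (v.inl Δ)) (hT.seq_inl hΦ Δ) γ δ hγδ
  simpa only [Term.subst, Subst.append_inl] using this

theorem seq_conn (hT : MinClosed T) {n : ℕ} (k : L.Conn n) {φ ψ : Fin n → Formula L Sg Γ}
    (hφψ : ∀ i, Assertion.seq [φ i] (ψ i) ∈ T) (hψφ : ∀ i, Assertion.seq [ψ i] (φ i) ∈ T) :
    Assertion.seq [.conn k φ] (.conn k ψ) ∈ T :=
  hT (.connCong k φ ψ)
    (Set.union_subset (Set.range_subset_iff.2 hφψ) (Set.range_subset_iff.2 hψφ))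

theorem seq_tensor_iff (hT : MinClosed T) (Φ Ψ : List (Formula L Sg Γ))
    (α β θ : Formula L Sg Γ) :
    Assertion.seq (Φ ++ α.tensor β :: Ψ) θ ∈ T ↔ Assertion.seq (Φ ++ α :: β :: Ψ) θ ∈ T :=
  ⟨fun hs => hT (.tensorRefInv Φ Ψ α β θ) (Set.singleton_subset_iff.2 hs),
    fun hs => hT (.tensorRef Φ Ψ α β θ) (Set.singleton_subset_iff.2 hs)⟩

theorem seq_unit_iff (hT : MinClosed T) (Φ Ψ : List (Formula L Sg Γ)) (θ : Formula L Sg Γ) :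
    Assertion.seq (Φ ++ .unit :: Ψ) θ ∈ T ↔ Assertion.seq (Φ ++ Ψ) θ ∈ T :=
  ⟨fun hs => hT (.unitRef Φ Ψ θ) (Set.singleton_subset_iff.2 hs),
    fun hs => hT (.unitRefInv Φ Ψ θ) (Set.singleton_subset_iff.2 hs)⟩

/-- Reduces sequents with many premises to sequents with one, the only kind that the order of `P_T`
sees. The prefix `Φ` collects the formulas already split off. -/
theorem seq_foldr_iff (hT : MinClosed T) (Φ Ψ : List (Formula L Sg Γ)) (θ : Formula L Sg Γ) :
    Assertion.seq (Φ ++ [Ψ.foldr Formula.tensor .unit]) θ ∈ T ↔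
      Assertion.seq (Φ ++ Ψ) θ ∈ T := by
  induction Ψ generalizing Φ with
  | nil => exact hT.seq_unit_iff Φ [] θ
  | cons ψ Ψ ih =>
    rw [List.foldr_cons, hT.seq_tensor_iff]
    simpa only [List.append_assoc, List.singleton_append] using ih (Φ ++ [ψ])

/-- Both sides unfold to `α, β, χ ⊢ θ`. -/
theorem seq_assoc_iff (hT : MinClosed T) (α β χ θ : Formula L Sg Γ) :
    Assertion.seq [(α.tensor β).tensor χ] θ ∈ T ↔
      Assertion.seq [α.tensor (β.tensor χ)] θ ∈ T :=
  (hT.seq_tensor_iff [] [] _ _ _).trans <| (hT.seq_tensor_iff [] [χ] _ _ _).trans <|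
    (hT.seq_tensor_iff [α] [] _ _ _).symm.trans (hT.seq_tensor_iff [] [] _ _ _).symm

theorem seq_unit_tensor_iff (hT : MinClosed T) (α θ : Formula L Sg Γ) :
    Assertion.seq [Formula.tensor .unit α] θ ∈ T ↔ Assertion.seq [α] θ ∈ T :=
  (hT.seq_tensor_iff [] [] _ _ _).trans (hT.seq_unit_iff [] [α] θ)

theorem seq_tensor_unit_iff (hT : MinClosed T) (α θ : Formula L Sg Γ) :
    Assertion.seq [α.tensor .unit] θ ∈ T ↔ Assertion.seq [α] θ ∈ T :=
  (hT.seq_tensor_iff [] [] _ _ _).trans (hT.seq_unit_iff [α] [] θ)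

theorem wellDefined (hT : MinClosed T) : WellDefined T where
  eq_refl := hT.eqn_refl
  eq_symm _ _ := hT.eqn_symm
  eq_trans _ _ _ := hT.eqn_trans
  eq_subst _ _ _ _ := hT.eqn_subst
  le_refl := hT.seq_ax
  le_trans _ _ _ := hT.seq_cut
  le_subst _ _ _ := hT.seq_subst fun _ _ => hT.eqn_refl _
  subst_congr _ _ φ hγδ := hT.seq_subst hγδ (hT.seq_ax φ)
  conn_congr k _ _ := hT.seq_conn k
  quant_congr Q σ φ ψ hφψ hψφ := hT (.quantCong Q σ φ ψ) (Set.pair_subset hφψ hψφ)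

end MinClosed
/-! ## Soundness -/

/-! ### Morphisms into the product of a context -/

section Tuples

variable {C : Type o} [Category.{h} C] [CartesianMonoidalCategory C] {S : Type u} (F : S → C)

theorem ctxTuple_proj {c : C} {Γ : Ctx S} (g : ∀ σ : S, Var Γ σ → (c ⟶ F σ)) {σ : S}
    (v : Var Γ σ) : ctxTuple F g ≫ ctxProj F v = g σ v := by
  induction v with
  | zero => exact lift_snd _ _
  | succ v ih =>
    exact (lift_fst_assoc (ctxTuple F fun _ w => g _ (.succ w)) (g _ .zero) _).trans (ih _)

theorem ctxObj_hom_ext {c : C} {Γ : Ctx S} {f g : c ⟶ ctxObj F Γ}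
    (hfg : ∀ (σ : S) (v : Var Γ σ), f ≫ ctxProj F v = g ≫ ctxProj F v) : f = g := by
  induction Γ with
  | nil => exact toUnit_unique f g
  | cons σ Γ ih =>
    refine CartesianMonoidalCategory.hom_ext _ _ (ih fun τ v => ?_) (hfg σ .zero)
    exact (Category.assoc f _ _).trans ((hfg τ (.succ v)).trans (Category.assoc g _ _).symm)

theorem comp_ctxTuple {b c : C} (f : b ⟶ c) {Γ : Ctx S} (g : ∀ σ : S, Var Γ σ → (c ⟶ F σ)) :
    f ≫ ctxTuple F g = ctxTuple F fun σ v => f ≫ g σ v :=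
  ctxObj_hom_ext F fun σ v => by simp only [Category.assoc, ctxTuple_proj]

end Tuples

/-! ### Reindexing and the monoid operations -/

section Pull

theorem PropCategory.pull_comp (X : PropCategory.{o, h, p}) {b c d : X.C} (f : b ⟶ c) (g : c ⟶ d)
    (a : X.Pred d) : X.pull (f ≫ g) a = X.pull f (X.pull g a) := by
  simp only [PropCategory.pull, op_comp, Functor.map_comp]
  rfl

theorem PropCategory.pull_mono (X : PropCategory.{o, h, p}) {c d : X.C} (f : c ⟶ d)
    {a b : X.Pred d} (hab : a ≤ b) : X.pull f a ≤ X.pull f b :=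
  (X.P.map f.op).hom.monotone hab

namespace FAData.IsFA

variable {L : FOLanguage.{u}} {X : FAData.{u, o, h, p} L}

theorem pull_unit (hX : X.IsFA) {c d : X.C} (f : c ⟶ d) : X.pull f (X.unit d) = X.unit c := by
  rw [FAData.unit, hX.pull_conn]
  exact congrArg _ (funext fun i => i.elim0)

theorem pull_tensor (hX : X.IsFA) {c d : X.C} (f : c ⟶ d) (a b : X.Pred d) :
    X.pull f (X.tensor a b) = X.tensor (X.pull f a) (X.pull f b) := by
  rw [FAData.tensor, hX.pull_conn]
  refine congrArg _ (funext fun i => ?_)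
  fin_cases i <;> rfl

theorem pull_tensorList (hX : X.IsFA) {c d : X.C} (f : c ⟶ d) (l : List (X.Pred d)) :
    X.pull f (X.tensorList l) = X.tensorList (l.map (X.pull f)) := by
  induction l with
  | nil => exact hX.pull_unit f
  | cons a l ih =>
    change X.pull f (X.tensor a (X.tensorList l)) = X.tensor _ (X.tensorList _)
    rw [hX.pull_tensor, ih]

theorem tensorList_append (hX : X.IsFA) {c : X.C} (l m : List (X.Pred c)) :
    X.tensorList (l ++ m) = X.tensor (X.tensorList l) (X.tensorList m) := by
  induction l with
  | nil => exact (hX.unit_tensor c _).symm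
  | cons a l ih =>
    change X.tensor a (X.tensorList (l ++ m)) = X.tensor (X.tensor a (X.tensorList l)) _
    rw [ih, hX.tensor_assoc]

theorem tensorList_singleton (hX : X.IsFA) {c : X.C} (a : X.Pred c) : X.tensorList [a] = a :=
  hX.tensor_unit c a

end FAData.IsFA
end Pull

/-! ### The semantic substitution lemmas and validity of the rules -/

namespace Struc

variable {L : FOLanguage.{u}} {Sg : Signature.{u}} {X : FAData.{u, o, h, p} L} (S : Struc Sg X)
  {Γ Δ : Ctx Sg.Srt}

/-- The interpretation of a substitution. -/
def subst (γ : Subst Sg Γ Δ) : S.ctx Δ ⟶ S.ctx Γ :=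
  ctxTuple S.obj fun σ v => S.term (γ σ v)

theorem term_subst (γ : Subst Sg Γ Δ) {τ : Sg.Srt} (M : Term Sg Γ τ) :
    S.term (M.subst γ) = S.subst γ ≫ S.term M := by
  induction M with
  | var v => exact (ctxTuple_proj S.obj (fun σ v => S.term (γ σ v)) v).symm
  | app f args ih =>
    simp only [Term.subst, term]
    rw [← Category.assoc, comp_ctxTuple]
    simp only [ih]

theorem subst_succ (σ : Sg.Srt) :
    S.subst (fun _ (v : Var Γ _) => Term.var (Var.succ (σ := σ) v)) =
      fst (S.ctx Γ) (S.obj σ) :=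
  ctxObj_hom_ext S.obj fun _ v => ctxTuple_proj S.obj _ v

theorem term_rename (ρ : Ren Γ Δ) {τ : Sg.Srt} (M : Term Sg Γ τ) :
    S.term (M.rename ρ) = S.subst (fun _ v => .var (ρ _ v)) ≫ S.term M := by
  rw [← S.term_subst, ← Term.subst_var (M.rename ρ), Term.subst_rename]

/-- Brings substitution under a binder into the form in which naturality of the quantifiers applies.
-/
theorem subst_lift (γ : Subst Sg Γ Δ) (σ : Sg.Srt) :
    S.subst (γ.lift σ) = S.subst γ ▷ S.obj σ := by
  refine CartesianMonoidalCategory.hom_ext _ _ (Eq.trans ?_ (whiskerRight_fst _ _).symm)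
    (Eq.trans ?_ (whiskerRight_snd _ _).symm)
  · refine ctxObj_hom_ext S.obj fun τ v => ?_
    refine (Category.assoc _ _ _).trans ?_
    refine (ctxTuple_proj S.obj (fun τ v => S.term (γ.lift σ τ v)) (.succ v)).trans ?_
    refine (S.term_rename _ _).trans ?_
    rw [S.subst_succ]
    refine Eq.trans ?_ (Category.assoc (fst (S.ctx Δ) (S.obj σ)) _ _).symm
    exact congrArg (fst (S.ctx Δ) (S.obj σ) ≫ ·)
      (ctxTuple_proj S.obj (fun τ v => S.term (γ τ v)) v).symm
  · exact ctxTuple_proj S.obj (fun τ v => S.term (γ.lift σ τ v)) .zero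

/-- Functoriality of `P` handles atomic formulas, the homomorphism property connectives, and
naturality in the first index quantifiers. -/
theorem formula_subst (hX : X.IsFA) (γ : Subst Sg Γ Δ) (φ : Formula L Sg Γ) :
    S.formula (φ.subst γ) = X.pull (S.subst γ) (S.formula φ) := by
  induction φ generalizing Δ with
  | rel R args =>
    simp only [Formula.subst, formula]
    rw [← X.pull_comp, comp_ctxTuple]
    simp only [S.term_subst]
  | eq M N =>
    simp only [Formula.subst, formula]
    rw [← X.pull_comp, comp_lift, S.term_subst, S.term_subst]
  | conn k φ ih =>
    simp only [Formula.subst, formula]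
    rw [hX.pull_conn]
    simp only [ih]
  | quant Q σ φ ih =>
    simp only [Formula.subst, formula]
    refine Eq.trans ?_ (hX.pull_quant Q (S.obj σ) (S.subst γ) (S.formula φ)).symm
    rw [ih, S.subst_lift]
    rfl

theorem tensorList_subst (hX : X.IsFA) (γ : Subst Sg Γ Δ) (Φ : List (Formula L Sg Γ)) :
    X.tensorList ((Φ.map (Formula.subst γ)).map S.formula) =
      X.pull (S.subst γ) (X.tensorList (Φ.map S.formula)) := by
  rw [hX.pull_tensorList, List.map_map, List.map_map]
  exact congrArg _ (List.map_congr_left fun φ _ => S.formula_subst hX γ φ)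

theorem sat_singleton (hX : X.IsFA) (φ ψ : Formula L Sg Γ) :
    S.Sat (.seq [φ] ψ) ↔ S.formula φ ≤ S.formula ψ := by
  change X.tensorList [S.formula φ] ≤ _ ↔ _
  rw [hX.tensorList_singleton]

theorem formula_unit : S.formula (Formula.unit : Formula L Sg Γ) = X.unit (S.ctx Γ) :=
  congrArg (X.conn (S.ctx Γ) L.unit) (funext fun i => i.elim0)

theorem formula_tensor (φ ψ : Formula L Sg Γ) :
    S.formula (φ.tensor ψ) = X.tensor (S.formula φ) (S.formula ψ) :=
  congrArg (X.conn (S.ctx Γ) L.tensor) (funext fun i => by fin_cases i <;> rfl)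

/-- The substitutions differ only at the replaced variable, and there the interpretation factors
through that of `M` or `N`. -/
theorem subst_single_congr {Θ : Ctx Sg.Srt} {σ : Sg.Srt} (ρ : Ren Θ (Δ ++ Γ)) {M N : Term Sg Θ σ}
    (hMN : S.term M = S.term N) :
    S.subst (Subst.single Γ Δ (M.rename ρ)) = S.subst (Subst.single Γ Δ (N.rename ρ)) := by
  refine congrArg (ctxTuple S.obj) (funext fun τ => funext fun v => ?_)
  rcases v.append_cases with ⟨w, rfl⟩ | ⟨w, rfl⟩
  · cases w with
    | zero => rw [Subst.single_inl_zero, Subst.single_inl_zero, S.term_rename, S.term_rename, hMN]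
    | succ w => rw [Subst.single_inl_succ, Subst.single_inl_succ]
  · rw [Subst.single_inr, Subst.single_inr]

/-- An equality by associativity, so (`⊗`-Ref) is valid in both directions without monotonicity of
`⊗`. -/
theorem tensorList_tensor (hX : X.IsFA) (Φ Ψ : List (Formula L Sg Γ)) (α β : Formula L Sg Γ) :
    X.tensorList ((Φ ++ α.tensor β :: Ψ).map S.formula) =
      X.tensorList ((Φ ++ α :: β :: Ψ).map S.formula) := by
  simp only [List.map_append, List.map_cons, hX.tensorList_append, S.formula_tensor]
  exact congrArg _ (hX.tensor_assoc _ _ _ _)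

theorem tensorList_unit (hX : X.IsFA) (Φ Ψ : List (Formula L Sg Γ)) :
    X.tensorList ((Φ ++ .unit :: Ψ).map S.formula) =
      X.tensorList ((Φ ++ Ψ).map S.formula) := by
  simp only [List.map_append, List.map_cons, hX.tensorList_append, S.formula_unit]
  exact congrArg _ (hX.unit_tensor _ _)

/-- In the congruence rules the two-way premises become equalities by antisymmetry, so neither
connectives nor quantifiers need be monotone. Cut has a single formula on the left, so it is
transitivity of the order. -/
theorem th_minClosed (hX : X.IsFA) : MinClosed S.th := by
  intro A a r hA
  cases r with
  | equational r =>
    cases r with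
    | refl M => exact rfl
    | symm M N =>
      have h₁ : S.term M = S.term N := hA rfl
      exact h₁.symm
    | trans M N K =>
      have h₁ : S.term M = S.term N := hA (.inl rfl)
      have h₂ : S.term N = S.term K := hA (.inr rfl)
      exact h₁.trans h₂
    | subst ρ hρ M M₁ N N₁ =>
      have h₁ : S.term M = S.term M₁ := hA (.inl rfl)
      have h₂ : S.term N = S.term N₁ := hA (.inr rfl)
      change S.term _ = S.term _
      rw [S.term_subst, S.term_subst, h₂, S.subst_single_congr ρ h₁]
  | ax φ => exact (S.sat_singleton hX _ _).2 le_rfl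
  | cut φ ψ θ =>
    have h₁ := (S.sat_singleton hX φ ψ).1 (hA (.inl rfl))
    have h₂ := (S.sat_singleton hX ψ θ).1 (hA (.inr rfl))
    exact (S.sat_singleton hX _ _).2 (h₁.trans h₂)
  | cwk σ Φ ψ =>
    have h₁ : X.tensorList (Φ.map S.formula) ≤ S.formula ψ := hA rfl
    change X.tensorList ((Φ.map (Formula.subst _)).map S.formula) ≤ S.formula (ψ.subst _)
    rw [S.tensorList_subst hX, S.formula_subst hX]
    exact X.pull_mono _ h₁
  | sub ρ hρ M M₁ Φ ψ =>
    have h₁ : S.term M = S.term M₁ := hA (.inl rfl)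
    have h₂ : X.tensorList (Φ.map S.formula) ≤ S.formula ψ := hA (.inr rfl)
    change X.tensorList ((Φ.map (Formula.subst _)).map S.formula) ≤ S.formula (ψ.subst _)
    rw [S.tensorList_subst hX, S.formula_subst hX, S.subst_single_congr ρ h₁]
    exact X.pull_mono _ h₂
  | quantCong Q σ φ ψ =>
    have h₁ := (S.sat_singleton hX φ ψ).1 (hA (.inl rfl))
    have h₂ := (S.sat_singleton hX ψ φ).1 (hA (.inr rfl))
    refine (S.sat_singleton hX _ _).2 (le_of_eq ?_)
    simp only [formula]
    rw [le_antisymm h₁ h₂]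
  | connCong k φ ψ =>
    refine (S.sat_singleton hX _ _).2 (le_of_eq ?_)
    simp only [formula]
    refine congrArg _ (funext fun i => le_antisymm ?_ ?_)
    · exact (S.sat_singleton hX _ _).1 (hA (.inl ⟨i, rfl⟩))
    · exact (S.sat_singleton hX _ _).1 (hA (.inr ⟨i, rfl⟩))
  | tensorRef Φ Ψ α β θ =>
    exact (S.tensorList_tensor hX Φ Ψ α β).trans_le (hA rfl)
  | tensorRefInv Φ Ψ α β θ =>
    exact (S.tensorList_tensor hX Φ Ψ α β).symm.trans_le (hA rfl)
  | unitRef Φ Ψ θ =>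
    exact (S.tensorList_unit hX Φ Ψ).symm.trans_le (hA rfl)
  | unitRefInv Φ Ψ θ =>
    exact (S.tensorList_unit hX Φ Ψ).trans_le (hA rfl)

end Struc

theorem minimalLogic_sound {L : FOLanguage.{u}} {Sg : Signature.{u}} {X : FAData.{u, o, h, p} L}
    (hX : X.IsFA) (S : Struc Sg X) {T U : Theory L Sg} (hTU : (minimalLogic L).Derives T U)
    (hT : T ⊆ S.th) : U ⊆ S.th :=
  fun _ ha => (S.th_minClosed hX).mem_of_derivable hT (hTU ha)

/-! ## The classifying prop-category of a theory of the minimal logic -/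

theorem Formula.unit_subst {L : FOLanguage.{u}} {Sg : Signature.{u}} {Γ Δ : Ctx Sg.Srt}
    (γ : Subst Sg Γ Δ) : (Formula.unit : Formula L Sg Γ).subst γ = .unit :=
  congrArg (Formula.conn L.unit) (funext fun i => i.elim0)

theorem Formula.tensor_subst {L : FOLanguage.{u}} {Sg : Signature.{u}} {Γ Δ : Ctx Sg.Srt}
    (γ : Subst Sg Γ Δ) (φ ψ : Formula L Sg Γ) :
    (φ.tensor ψ).subst γ = (φ.subst γ).tensor (ψ.subst γ) :=
  congrArg (Formula.conn L.tensor) (funext fun i => by fin_cases i <;> rfl)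

theorem eqFormula_subst {L : FOLanguage.{u}} {Sg : Signature.{u}} {Γ Δ Θ : Ctx Sg.Srt}
    (γ δ : Subst Sg Γ Δ) (κ : Subst Sg Δ Θ) :
    (eqFormula γ δ : Formula L Sg Δ).subst κ =
      eqFormula (fun _ v => (γ _ v).subst κ) (fun _ v => (δ _ v).subst κ) := by
  induction Γ with
  | nil => exact Formula.unit_subst κ
  | cons σ Γ ih =>
    rw [eqFormula, Formula.tensor_subst, ih]
    rfl

/-- The extension of a substitution by the identity on the variables of `Δ`. -/
def Subst.liftCtx {Sg : Signature.{u}} {Γ Θ : Ctx Sg.Srt} (γ : Subst Sg Γ Θ) (Δ : Ctx Sg.Srt) :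
    Subst Sg (Δ ++ Γ) (Δ ++ Θ) :=
  Subst.append (fun _ v => (γ _ v).subst fun _ w => .var (w.inl Δ)) fun _ v => .var (v.inr Θ)

theorem Subst.liftCtx_nil {Sg : Signature.{u}} {Γ Θ : Ctx Sg.Srt} (γ : Subst Sg Γ Θ) :
    γ.liftCtx [] = γ :=
  funext fun _ => funext fun _ => Term.subst_var _

/-- Lets substitution pass a block of quantifiers one binder at a time. -/
theorem Subst.liftCtx_cons {Sg : Signature.{u}} {Γ Θ : Ctx Sg.Srt} (γ : Subst Sg Γ Θ)
    (σ : Sg.Srt) (Δ : Ctx Sg.Srt) : γ.liftCtx (σ :: Δ) = (γ.liftCtx Δ).lift σ := by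
  funext τ v
  cases v with
  | zero => rfl
  | succ v =>
    rw [Subst.lift]
    rcases v.append_cases with ⟨w, rfl⟩ | ⟨w, rfl⟩
    · rw [Subst.liftCtx, Subst.liftCtx, Subst.append_inl, Term.rename_subst]
      exact Subst.append_inl _ _ w
    · rw [Subst.liftCtx, Subst.liftCtx, Subst.append_inr]
      exact Subst.append_inr _ _ (.succ w)

/-- The isomorphism between the contexts `(Γ, Δ), Θ` and `Γ, (Δ, Θ)`. -/
def Subst.assoc {Sg : Signature.{u}} (Γ Δ Θ : Ctx Sg.Srt) :
    Subst Sg (Θ ++ (Δ ++ Γ)) ((Θ ++ Δ) ++ Γ) :=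
  Subst.append
    (Subst.append (fun _ v => .var (v.inl (Θ ++ Δ))) fun _ v => .var ((v.inl Θ).inr Γ))
    fun _ v => .var ((v.inr Δ).inr Γ)

theorem Subst.assoc_nil {Sg : Signature.{u}} (Γ Δ : Ctx Sg.Srt) :
    Subst.assoc Γ Δ [] = fun _ v => .var v :=
  Subst.append_eta (Γ := Γ) (Δ := Δ) fun _ v => .var v

/-- Lets the re-bracketing pass the quantifiers over `Θ` one binder at a time; at `Θ = []` it is the
identity. -/
theorem Subst.assoc_cons {Sg : Signature.{u}} (Γ Δ : Ctx Sg.Srt) (σ : Sg.Srt) (Θ : Ctx Sg.Srt) :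
    Subst.assoc Γ Δ (σ :: Θ) = (Subst.assoc Γ Δ Θ).lift σ := by
  funext τ v
  cases v with
  | zero => rfl
  | succ v =>
    rw [Subst.lift]
    rcases v.append_cases with ⟨w, rfl⟩ | ⟨w, rfl⟩
    · rw [Subst.assoc, Subst.assoc, Subst.append_inl]
      refine (Subst.append_inl _ _ w).trans ?_
      rcases w.append_cases with ⟨x, rfl⟩ | ⟨x, rfl⟩
      · rw [Subst.append_inl, Subst.append_inl]
        rfl
      · rw [Subst.append_inr, Subst.append_inr]
        rfl
    · rw [Subst.assoc, Subst.assoc, Subst.append_inr]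
      exact Subst.append_inr _ _ (.succ w)

/-! ### Operations on classes of formulas and the products of `C_T` -/

namespace WellDefined

variable {L : FOLanguage.{u}} {Sg : Signature.{u}} {T : Theory L Sg} (hT : WellDefined T)
  {Γ Δ Θ : Ctx Sg.Srt}

/-- The class of a formula in `P_T(Γ)`. -/
abbrev cls (φ : Formula L Sg Γ) : Quotient (hT.formulaSetoid Γ) :=
  Quotient.mk _ φ

/-- The action of a connective on classes of formulas. -/
noncomputable def connClass {n : ℕ} (k : L.Conn n) (a : Fin n → Quotient (hT.formulaSetoid Γ)) :
    Quotient (hT.formulaSetoid Γ) :=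
  hT.cls (.conn k fun i => Quotient.out (s := hT.formulaSetoid Γ) (a i))

/-- The representatives chosen by `Quotient.out` are interderivable with the given ones, so
congruence of the connective removes the choice. -/
theorem connClass_cls {n : ℕ} (k : L.Conn n) (φ : Fin n → Formula L Sg Γ) :
    hT.connClass k (fun i => hT.cls (φ i)) = hT.cls (.conn k φ) :=
  have hφ i := Quotient.mk_out (s := hT.formulaSetoid Γ) (φ i)
  Quotient.sound ⟨hT.conn_congr _ _ _ (fun i => (hφ i).1) fun i => (hφ i).2,
    hT.conn_congr _ _ _ (fun i => (hφ i).2) fun i => (hφ i).1⟩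

theorem exists_cls {n : ℕ} (a : Fin n → Quotient (hT.formulaSetoid Γ)) :
    ∃ φ : Fin n → Formula L Sg Γ, a = fun i => hT.cls (φ i) :=
  ⟨fun i => (a i).out, funext fun i => (Quotient.out_eq (a i)).symm⟩

theorem substClass_connClass (γ : Quotient (hT.substSetoid Γ Δ)) {n : ℕ} (k : L.Conn n)
    (a : Fin n → Quotient (hT.formulaSetoid Γ)) :
    hT.substClass γ (hT.connClass k a) = hT.connClass k fun i => hT.substClass γ (a i) := by
  obtain ⟨φ, rfl⟩ := hT.exists_cls a
  induction γ using Quotient.inductionOn with | _ γ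
  rw [hT.connClass_cls]
  exact (hT.connClass_cls k fun i => (φ i).subst γ).symm

/-- The tensor product of classes of formulas. -/
noncomputable def tensorClass (a b : Quotient (hT.formulaSetoid Γ)) :
    Quotient (hT.formulaSetoid Γ) :=
  hT.connClass L.tensor ![a, b]

theorem tensorClass_cls (φ ψ : Formula L Sg Γ) :
    hT.tensorClass (hT.cls φ) (hT.cls ψ) = hT.cls (φ.tensor ψ) := by
  refine Eq.trans (congrArg (hT.connClass L.tensor) (funext fun i => ?_))
    (hT.connClass_cls L.tensor ![φ, ψ])
  fin_cases i <;> rfl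

/-- The unit of the tensor product of classes of formulas. -/
noncomputable def unitClass (Γ : Ctx Sg.Srt) : Quotient (hT.formulaSetoid Γ) :=
  hT.connClass L.unit Fin.elim0

theorem unitClass_eq (Γ : Ctx Sg.Srt) : hT.unitClass Γ = hT.cls .unit :=
  congrArg (fun φ => hT.cls (.conn L.unit φ)) (funext fun i => i.elim0)

theorem substClass_quantClass (Q : L.Quant) (γ : Subst Sg Γ Θ) (Δ : Ctx Sg.Srt)
    (φ : Formula L Sg (Δ ++ Γ)) :
    hT.substClass (Quotient.mk _ γ) (hT.quantClass Q Γ Δ (hT.cls φ)) =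
      hT.quantClass Q Θ Δ (hT.cls (φ.subst (γ.liftCtx Δ))) := by
  induction Δ with
  | nil =>
    rw [Subst.liftCtx_nil]
    rfl
  | cons σ Δ ih =>
    rw [Subst.liftCtx_cons]
    -- Substitution in a quantified formula is by definition the lifted substitution in its body.
    exact ih (.quant Q σ φ)

theorem quantClass_append (Q : L.Quant) (Γ Δ Θ : Ctx Sg.Srt) (φ : Formula L Sg (Θ ++ (Δ ++ Γ))) :
    hT.quantClass Q Γ (Θ ++ Δ) (hT.cls (φ.subst (Subst.assoc Γ Δ Θ))) =
      hT.quantClass Q Γ Δ (hT.quantClass Q (Δ ++ Γ) Θ (hT.cls φ)) := by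
  induction Θ with
  | nil =>
    rw [Subst.assoc_nil, Formula.subst_var]
    rfl
  | cons σ Θ ih =>
    rw [Subst.assoc_cons]
    exact ih (.quant Q σ φ)

theorem hom_append_fst (γ : Subst Sg Γ Θ) (δ : Subst Sg Δ Θ) :
    hT.hom (γ.append δ) ≫ fst (ClassObj.mk Γ : ClassObj hT) (ClassObj.mk Δ) = hT.hom γ :=
  congrArg (Quotient.mk _) (funext fun _ => funext fun v => Subst.append_inl _ _ v)

theorem hom_append_snd (γ : Subst Sg Γ Θ) (δ : Subst Sg Δ Θ) :
    hT.hom (γ.append δ) ≫ snd (ClassObj.mk Γ : ClassObj hT) (ClassObj.mk Δ) = hT.hom δ :=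
  congrArg (Quotient.mk _) (funext fun _ => funext fun v => Subst.append_inr _ _ v)

theorem hom_whiskerRight (γ : Subst Sg Γ Θ) (Δ : Ctx Sg.Srt) :
    hT.hom γ ▷ (ClassObj.mk Δ : ClassObj hT) = hT.hom (γ.liftCtx Δ) :=
  CartesianMonoidalCategory.hom_ext _ _
    ((whiskerRight_fst _ _).trans (hT.hom_append_fst _ _).symm)
    ((whiskerRight_snd _ _).trans (hT.hom_append_snd _ _).symm)

theorem associator_inv (Γ Δ Θ : Ctx Sg.Srt) :
    (α_ (ClassObj.mk Γ : ClassObj hT) (ClassObj.mk Δ) (ClassObj.mk Θ)).inv =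
      hT.hom (Subst.assoc Γ Δ Θ) := by
  refine CartesianMonoidalCategory.hom_ext _ _ (Eq.trans ?_ (hT.hom_append_fst _ _).symm)
    ((associator_inv_snd _ _ _).trans (hT.hom_append_snd _ _).symm)
  refine CartesianMonoidalCategory.hom_ext _ _ (Eq.trans ?_ (hT.hom_append_fst _ _).symm)
    (Eq.trans ?_ (hT.hom_append_snd _ _).symm)
  · exact (Category.assoc _ _ _).trans (associator_inv_fst_fst _ _ _)
  · exact (Category.assoc _ _ _).trans (associator_inv_fst_snd _ _ _)

end WellDefined

/-! ### The conditions for membership in `FA` -/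

namespace MinClosed

variable {L : FOLanguage.{u}} {Sg : Signature.{u}} {T : Theory L Sg} {Γ Δ Θ : Ctx Sg.Srt}

/-- The Yoneda argument for a preorder. It turns the refinement rules, which compare consequences,
into the monoid equations. -/
theorem cls_eq (hM : MinClosed T) (hT : WellDefined T) {φ ψ : Formula L Sg Γ}
    (hφψ : ∀ θ, Assertion.seq [φ] θ ∈ T ↔ Assertion.seq [ψ] θ ∈ T) : hT.cls φ = hT.cls ψ :=
  Quotient.sound ⟨(hφψ ψ).2 (hM.seq_ax ψ), (hφψ φ).1 (hM.seq_ax φ)⟩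

theorem tensorClass_assoc (hM : MinClosed T) (hT : WellDefined T)
    (a b c : Quotient (hT.formulaSetoid Γ)) :
    hT.tensorClass (hT.tensorClass a b) c = hT.tensorClass a (hT.tensorClass b c) := by
  induction a using Quotient.inductionOn with | _ φ
  induction b using Quotient.inductionOn with | _ ψ
  induction c using Quotient.inductionOn with | _ χ
  simp only [hT.tensorClass_cls]
  exact hM.cls_eq hT (hM.seq_assoc_iff φ ψ χ)

theorem unitClass_tensorClass (hM : MinClosed T) (hT : WellDefined T)
    (a : Quotient (hT.formulaSetoid Γ)) : hT.tensorClass (hT.unitClass Γ) a = a := by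
  induction a using Quotient.inductionOn with | _ φ
  rw [hT.unitClass_eq, hT.tensorClass_cls]
  exact hM.cls_eq hT (hM.seq_unit_tensor_iff φ)

theorem tensorClass_unitClass (hM : MinClosed T) (hT : WellDefined T)
    (a : Quotient (hT.formulaSetoid Γ)) : hT.tensorClass a (hT.unitClass Γ) = a := by
  induction a using Quotient.inductionOn with | _ φ
  rw [hT.unitClass_eq, hT.tensorClass_cls]
  exact hM.cls_eq hT (hM.seq_tensor_unit_iff φ)

/-- The unit law removes the initial `e` of the factor for `Δ`, and each variable of `Δ` costs one
use of associativity. This is the condition on `Eq` of a product, before substitution of the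
projections. -/
theorem eqFormula_append (hM : MinClosed T) (hT : WellDefined T) (Γ Δ : Ctx Sg.Srt)
    (γ δ : Subst Sg (Δ ++ Γ) Θ) :
    hT.cls (eqFormula γ δ) = hT.tensorClass
      (hT.cls (eqFormula (fun _ v => γ _ (v.inl Δ)) fun _ v => δ _ (v.inl Δ)))
      (hT.cls (eqFormula (fun _ v => γ _ (v.inr Γ)) fun _ v => δ _ (v.inr Γ))) := by
  induction Δ with
  | nil =>
    simp only [eqFormula]
    rw [← hT.unitClass_eq, hM.tensorClass_unitClass]
    rfl
  | cons σ Δ ih =>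
    have h₁ := ih (fun _ v => γ _ (.succ v)) fun _ v => δ _ (.succ v)
    refine (hT.tensorClass_cls _ _).symm.trans ((congrArg (hT.tensorClass · _) h₁).trans ?_)
    rw [hM.tensorClass_assoc, hT.tensorClass_cls _ (.eq _ _)]
    rfl

theorem isFA_classifying (hM : MinClosed T) (hT : WellDefined T) : (classifying T hT).IsFA where
  pull_conn f _ k a := hT.substClass_connClass f k a
  pull_quant Q b d c f a := by
    obtain ⟨φ, rfl⟩ := Quotient.exists_rep (s := hT.formulaSetoid _) a
    obtain ⟨γ, rfl⟩ := Quotient.exists_rep (s := hT.substSetoid _ _) f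
    refine (hT.substClass_quantClass Q γ (ClassObj.ctx (hT := hT) c) φ).trans ?_
    exact congrArg (fun f => hT.quantClass Q _ (ClassObj.ctx (hT := hT) c)
      (hT.substClass f (hT.cls φ))) (hT.hom_whiskerRight γ (ClassObj.ctx (hT := hT) c)).symm
  tensor_assoc _ a b c := hM.tensorClass_assoc hT a b c
  unit_tensor _ a := hM.unitClass_tensorClass hT a
  tensor_unit _ a := hM.tensorClass_unitClass hT a
  quant_one Q b a := by
    obtain ⟨φ, rfl⟩ := Quotient.exists_rep (s := hT.formulaSetoid _) a
    -- The first projection from `b ⊗ 𝟙_` is represented by the identity substitution, and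
    -- quantification over the empty context does nothing.
    exact congrArg hT.cls (Formula.subst_var φ)
  quant_prod Q b c d a := by
    obtain ⟨φ, rfl⟩ := Quotient.exists_rep (s := hT.formulaSetoid _) a
    refine Eq.trans ?_ (hT.quantClass_append Q (ClassObj.ctx (hT := hT) b)
      (ClassObj.ctx (hT := hT) c) (ClassObj.ctx (hT := hT) d) φ)
    exact congrArg (fun f => hT.quantClass Q _ _ (hT.substClass f (hT.cls φ)))
      (hT.associator_inv (ClassObj.ctx (hT := hT) b) (ClassObj.ctx (hT := hT) c)
        (ClassObj.ctx (hT := hT) d))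
  eq_one := (hT.unitClass_eq _).symm
  eq_prod c d := by
    refine (hM.eqFormula_append hT (ClassObj.ctx (hT := hT) c) (ClassObj.ctx (hT := hT) d)
      _ _).trans (congrArg₂ hT.tensorClass ?_ ?_)
    all_goals
      refine congrArg hT.cls (Eq.trans ?_ (eqFormula_subst _ _ (Subst.append _ _)).symm)
      simp only [Term.subst, Subst.append_inl, Subst.append_inr]

end MinClosed
/-! ## The generic model -/

/-- A term as a substitution for a single variable. -/
def Subst.one {Sg : Signature.{u}} {Γ : Ctx Sg.Srt} {σ : Sg.Srt} (M : Term Sg Γ σ) :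
    Subst Sg [σ] Γ
  | _, .zero => M

namespace WellDefined

variable {L : FOLanguage.{u}} {Sg : Signature.{u}} {T : Theory L Sg} (hT : WellDefined T)
  {Γ Δ Θ : Ctx Sg.Srt}

theorem hom_comp_one {σ : Sg.Srt} (M : Term Sg Γ σ) (γ : Subst Sg Γ Δ) :
    hT.hom γ ≫ hT.hom (Subst.one M) = hT.hom (Subst.one (M.subst γ)) :=
  congrArg hT.hom (funext fun _ => funext fun v => by
    cases v with
    | zero => rfl
    | succ v => exact nomatch v)

theorem hom_one_eq_iff {σ : Sg.Srt} (M N : Term Sg Γ σ) :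
    hT.hom (Subst.one M) = hT.hom (Subst.one N) ↔ Assertion.eqn M N ∈ T := by
  refine ⟨fun hMN => Quotient.exact hMN σ .zero, fun hMN => Quotient.sound fun τ v => ?_⟩
  cases v with
  | zero => exact hMN
  | succ v => exact nomatch v

/-- The interpretation of the sorts in the generic model. -/
def genericObj (σ : Sg.Srt) : ClassObj hT :=
  ⟨[σ]⟩

/-- The context that interprets the context `Γ` in the generic model. -/
def genericCtx (Γ : Ctx Sg.Srt) : Ctx Sg.Srt :=
  (ctxObj hT.genericObj Γ).ctx

/-- The variable of `genericCtx Γ` that corresponds to a variable of `Γ`. -/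
def toGeneric : {Γ : Ctx Sg.Srt} → {σ : Sg.Srt} → Var Γ σ → Var (hT.genericCtx Γ) σ
  | σ :: Γ, _, .zero => (Var.zero : Var (σ :: hT.genericCtx Γ) σ)
  | σ :: Γ, τ, .succ v => (Var.succ (toGeneric v) : Var (σ :: hT.genericCtx Γ) τ)

/-- The variable of `Γ` that corresponds to a variable of `genericCtx Γ`. -/
def ofGeneric : {Γ : Ctx Sg.Srt} → {σ : Sg.Srt} → Var (hT.genericCtx Γ) σ → Var Γ σ
  | [], σ => fun (v : Var [] σ) => nomatch v
  | σ :: Γ, τ => fun (v : Var (σ :: hT.genericCtx Γ) τ) =>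
    match v with
    | .zero => .zero
    | .succ v => .succ (ofGeneric v)

/-- `genericCtx Γ` is `Γ` rebuilt by iterated products, and not definitionally `Γ` for a variable
`Γ`. This retraction replaces transport along an equality of contexts. -/
theorem ofGeneric_toGeneric {σ : Sg.Srt} (v : Var Γ σ) :
    hT.ofGeneric (hT.toGeneric v) = v := by
  induction v with
  | zero => rfl
  | succ v ih => exact congrArg Var.succ ih

/-- The renaming of `Γ` into `genericCtx Γ` as a substitution. -/
def genericSubst (Γ : Ctx Sg.Srt) : Subst Sg Γ (hT.genericCtx Γ) :=
  fun _ v => .var (hT.toGeneric v)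

theorem genericSubst_cons (Γ : Ctx Sg.Srt) (σ : Sg.Srt) :
    hT.genericSubst (σ :: Γ) = (hT.genericSubst Γ).lift σ := by
  funext τ v
  cases v <;> rfl

/-- The generic model of `T`. -/
noncomputable def generic : Struc Sg (classifying T hT) where
  obj := hT.genericObj
  func f := hT.hom (Subst.one (.app f (hT.genericSubst (Sg.dom f))))
  rel R := hT.cls (.rel R (hT.genericSubst (Sg.arity R)))

theorem ctxProj_generic {σ : Sg.Srt} (v : Var Γ σ) :
    ctxProj hT.genericObj v = hT.hom (Subst.one (hT.genericSubst Γ σ v)) := by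
  induction v with
  | zero =>
    exact congrArg hT.hom (funext fun _ => funext fun v => by
      cases v with
      | zero => rfl
      | succ v => exact nomatch v)
  | succ v ih =>
    refine (congrArg (fst _ _ ≫ ·) ih).trans ?_
    exact hT.hom_comp_one _ _

/-- A tuple in the generic model is the substitution itself, read along `ofGeneric`; this is checked
on the projections. -/
theorem ctxTuple_generic (γ : Subst Sg Γ Δ) :
    ctxTuple hT.genericObj (c := ⟨Δ⟩) (fun σ v => hT.hom (Subst.one (γ σ v))) =
      hT.hom (Γ := hT.genericCtx Γ) fun _ v => γ _ (hT.ofGeneric v) := by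
  refine ctxObj_hom_ext hT.genericObj fun σ v => ?_
  refine (ctxTuple_proj hT.genericObj (fun σ v => hT.hom (Subst.one (γ σ v))) v).trans ?_
  rw [ctxProj_generic]
  refine Eq.trans ?_ (hT.hom_comp_one _ _).symm
  rw [genericSubst, Term.subst, ofGeneric_toGeneric]

/-- In the generic model every term denotes itself, up to the renaming of its context. -/
theorem generic_term {σ : Sg.Srt} (M : Term Sg Γ σ) :
    hT.generic.term M = hT.hom (Subst.one (M.subst (hT.genericSubst Γ))) := by
  induction M with
  | var v => exact hT.ctxProj_generic v
  | app f args ih =>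
    have h₁ := hT.ctxTuple_generic fun σ v => (args σ v).subst (hT.genericSubst Γ)
    rw [← funext fun σ => funext fun v => ih σ v] at h₁
    refine (congrArg (· ≫ hT.generic.func f) h₁).trans ((hT.hom_comp_one _ _).trans ?_)
    simp only [Term.subst, genericSubst, ofGeneric_toGeneric]

end WellDefined

namespace MinClosed

variable {L : FOLanguage.{u}} {Sg : Signature.{u}} {T : Theory L Sg} {Γ : Ctx Sg.Srt}

/-- The counterpart of `generic_term` for formulas; only the equality case uses a rule of the logic.
-/
theorem generic_formula (hM : MinClosed T) (hT : WellDefined T) (φ : Formula L Sg Γ) :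
    hT.generic.formula φ = hT.cls (φ.subst (hT.genericSubst Γ)) := by
  induction φ with
  | rel R args =>
    have h₁ := hT.ctxTuple_generic fun σ v => (args σ v).subst (hT.genericSubst _)
    rw [← funext fun σ => funext fun v => hT.generic_term (args σ v)] at h₁
    refine (congrArg (fun f => (classifying T hT).pull f (hT.generic.rel R)) h₁).trans ?_
    refine congrArg hT.cls (congrArg (Formula.rel R) ?_)
    simp only [Term.subst, WellDefined.genericSubst, WellDefined.ofGeneric_toGeneric]
  | eq M N =>
    simp only [Struc.formula, hT.generic_term]
    refine Eq.trans (congrArg hT.cls (eqFormula_subst _ _ (Subst.append (Subst.one _)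
      (Subst.one _)))) ?_
    -- `Eq` on a one-variable context is `e ⊗ (x = x')`, so the spurious `e` has to be absorbed.
    exact hM.cls_eq hT (hM.seq_unit_tensor_iff _)
  | conn k φ ih =>
    simp only [Struc.formula, ih]
    exact hT.connClass_cls k _
  | quant Q σ φ ih =>
    simp only [Struc.formula, ih]
    -- Quantification over the context `[σ]` is a single quantifier, so after this rewriting both
    -- sides agree by definition.
    rw [hT.genericSubst_cons]
    rfl

theorem generic_tensorList (hM : MinClosed T) (hT : WellDefined T) (Φ : List (Formula L Sg Γ)) :
    (classifying T hT).tensorList (Φ.map hT.generic.formula) =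
      hT.cls ((Φ.foldr Formula.tensor .unit).subst (hT.genericSubst Γ)) := by
  rw [← hM.generic_formula]
  induction Φ with
  | nil => exact hT.generic.formula_unit.symm
  | cons φ Φ ih =>
    refine Eq.trans ?_ (hT.generic.formula_tensor _ _).symm
    exact congrArg ((classifying T hT).tensor _) ih

theorem eqn_genericSubst_iff (hM : MinClosed T) (hT : WellDefined T) {σ : Sg.Srt}
    (M N : Term Sg Γ σ) :
    Assertion.eqn (M.subst (hT.genericSubst Γ)) (N.subst (hT.genericSubst Γ)) ∈ T ↔
      Assertion.eqn M N ∈ T := by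
  refine ⟨fun hMN => ?_, hM.eqn_subst fun _ _ => hM.eqn_refl _⟩
  have := hM.eqn_subst (γ := fun _ v => .var (hT.ofGeneric v)) (fun _ _ => hM.eqn_refl _) hMN
  simpa only [Term.subst_subst, WellDefined.genericSubst, Term.subst,
    WellDefined.ofGeneric_toGeneric, Term.subst_var] using this

/-- Derivability is stable under substitution, and `ofGeneric` undoes the renaming. -/
theorem seq_genericSubst_iff (hM : MinClosed T) (hT : WellDefined T) (φ ψ : Formula L Sg Γ) :
    Assertion.seq [φ.subst (hT.genericSubst Γ)] (ψ.subst (hT.genericSubst Γ)) ∈ T ↔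
      Assertion.seq [φ] ψ ∈ T := by
  refine ⟨fun hφψ => ?_, hM.seq_subst fun _ _ => hM.eqn_refl _⟩
  have := hM.seq_subst (γ := fun _ v => .var (hT.ofGeneric v)) (fun _ _ => hM.eqn_refl _) hφψ
  simpa only [List.map, Formula.subst_subst, WellDefined.genericSubst, Term.subst,
    WellDefined.ofGeneric_toGeneric, Formula.subst_var] using this

/-- Satisfaction in the generic model is membership in `T` of the renamed assertion, with the
premises of a sequent tensored together; `seq_foldr_iff` separates them again. -/
theorem generic_th (hM : MinClosed T) (hT : WellDefined T) : hT.generic.th = T := by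
  ext a
  cases a with
  | eqn M N =>
    change hT.generic.term M = hT.generic.term N ↔ _
    rw [hT.generic_term, hT.generic_term]
    exact (hT.hom_one_eq_iff _ _).trans (hM.eqn_genericSubst_iff hT M N)
  | seq Φ ψ =>
    change (classifying T hT).tensorList (Φ.map hT.generic.formula) ≤ hT.generic.formula ψ ↔ _
    rw [hM.generic_tensorList, hM.generic_formula]
    exact (hM.seq_genericSubst_iff hT _ ψ).trans (hM.seq_foldr_iff [] Φ ψ)

end MinClosed

/-! ### Adequacy, completeness and minimality -/

theorem minimalLogic_adequate (L : FOLanguage.{u}) : (minimalLogic L).Adequate := by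
  intro Sg T hT
  have hM := minimalLogic_minClosed hT
  exact ⟨hM.wellDefined, hM.isFA_classifying _, _, hM.generic_th _⟩

theorem Logic.isTheory_cl {L : FOLanguage.{u}} (𝓛 : Logic L) {Sg : Signature.{u}}
    (T : Theory L Sg) : 𝓛.IsTheory (𝓛.cl Sg T) :=
  (𝓛.cl Sg).idempotent T

/-- Soundness of the minimal logic is applied to the generic model of the `𝓛`-closure of `T`, whose
theory is exactly that closure. -/
theorem Logic.Adequate.derives_of_minimalLogic {L : FOLanguage.{u}} {𝓛 : Logic L}
    (hL : 𝓛.Adequate) {Sg : Signature.{u}} {T U : Theory L Sg}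
    (hTU : (minimalLogic L).Derives T U) : 𝓛.Derives T U := by
  obtain ⟨_, hX, G, hG⟩ := hL Sg _ (𝓛.isTheory_cl T)
  refine (minimalLogic_sound hX G hTU ?_).trans hG.subset
  rw [hG]
  exact (𝓛.cl Sg).le_closure T

/-- The generic model of the closure of `T` lies in a member of `K` and is a model of `T`, so it
satisfies `U`; but it satisfies only what is derivable from `T`. -/
theorem minimalLogic_complete {L : FOLanguage.{u}} {K : Set (FAData.{u, u, u, u} L)}
    (hK : ∀ (Sg : Signature.{u}) (T : Theory L Sg), (minimalLogic L).IsTheory T →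
      ∀ hT : WellDefined T, classifying T hT ∈ K)
    {Sg : Signature.{u}} {T U : Theory L Sg} (hTU : Entails K T U) :
    (minimalLogic L).Derives T U := by
  have hcl := (minimalLogic L).isTheory_cl T
  obtain ⟨hT, _, G, hG⟩ := minimalLogic_adequate L Sg _ hcl
  refine (hTU _ (hK Sg _ hcl hT) G ?_).trans hG.subset
  rw [hG]
  exact ((minimalLogic L).cl Sg).le_closure T

end FibLogic

theorem mainTheorem6 (L : FibLogic.FOLanguage.{u}) :
    (FibLogic.minimalLogic L).Adequate ∧
    (∀ K : Set (FibLogic.FAData.{u, o, h, p} L), (∀ X ∈ K, X.IsFA) →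
      ∀ (Sg : FibLogic.Signature.{u}) (T U : FibLogic.Theory L Sg),
        (FibLogic.minimalLogic L).Derives T U → FibLogic.Entails K T U) ∧
    (∀ K : Set (FibLogic.FAData.{u, u, u, u} L), (∀ X ∈ K, X.IsFA) →
      (∀ (Sg : FibLogic.Signature.{u}) (T : FibLogic.Theory L Sg),
        (FibLogic.minimalLogic L).IsTheory T →
          ∀ hT : FibLogic.WellDefined T, FibLogic.classifying T hT ∈ K) →
      ∀ (Sg : FibLogic.Signature.{u}) (T U : FibLogic.Theory L Sg),
        (FibLogic.minimalLogic L).Derives T U ↔ FibLogic.Entails K T U) ∧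
    (∀ 𝓛 : FibLogic.Logic L, 𝓛.Adequate →
      ∀ (Sg : FibLogic.Signature.{u}) (T U : FibLogic.Theory L Sg),
        (FibLogic.minimalLogic L).Derives T U → 𝓛.Derives T U) :=
  ⟨FibLogic.minimalLogic_adequate L,
    fun _ hK _ _ _ hTU X hX S hS => FibLogic.minimalLogic_sound (hK X hX) S hTU hS,
    fun _ hK hcl _ _ _ => ⟨fun hTU X hX S hS => FibLogic.minimalLogic_sound (hK X hX) S hTU hS,
      FibLogic.minimalLogic_complete hcl⟩,
    fun _ hL _ _ _ hTU => hL.derives_of_minimalLogic hTU⟩
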